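/- Let $d\ge 2$, $1\le p<\infty$, and let $w\in\mathcal A_p(\mathbb R^d)$ be a Muckenhoupt weight, i.e. $w\ge 0$ is locally integrable, $w>0$ a.e., and there is a constant $C$ such that for every ball $B$, \[ \Big(\frac1{|B|}\int_B w\,dx\Big)\Big(\frac1{|B|}\int_B w^{-\frac1{p-1}}\,dx\Big)^{p-1}\le C \quad (p>1),\qquad \frac1{|B|}\int_B w\,dx\le C\,w(y)\ \text{ for a.e. } y\in B \quad (p=1). \] Let $\dot W^{1,p}(\mathbb R^d,w)$ be the set of all Lebesgue representatives $u(x)=\limsup_{r\to0}\frac{1}{|B(x,r)|}\int_{B(x,r)}f(y)\,dy\in[-\infty,\infty]$ of functions $f\in L^p_{\mathrm{loc}}(\mathbb R^d,w\,dx)$ whose distributional gradient satisfies $|\nabla f|\in L^p(\mathbb R^d,w\,dx)$. Let $\sigma$ be the surface measure on the unit sphere $\mathbb S^{d-1}$, and let $B(x,r)$ be the open ball. A function $u$ has the unique almost sure radial limit $c\in\mathbb R$ if $\lim_{t\to\infty}u(t\xi)=c$ for $\sigma$-a.e. $\xi\in\mathbb S^{d-1}$. Consider the conditions (i) for every $u\in\dot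 W^{1,p}(\mathbb R^d,w)$ there is a $\xi\in\mathbb S^{d-1}$ with $\liminf_{t\to\infty}|u(t\xi)|<\infty$; (ii) every $u\in\dot W^{1,p}(\mathbb R^d,w)$ has a unique almost sure radial limit. If (i) or (ii) holds, then every $u\in\dot W^{1,p}(\mathbb R^d,w)$ has exactly one almost sure radial limit $c\in\mathbb R$, and \[ \text{(S)}\ \lim_{r\to\infty}\frac1{\sigma(\mathbb S^{d-1})}\int_{\mathbb S^{d-1}}|u(r\xi)-c|\,d\sigma(\xi)=0,\qquad \text{(A)}\ \lim_{t\to\infty}\frac1{|B(0,t)\setminus B(0,t/2)|}\int_{B(0,t)\setminus B(0,t/2)}|u-c|\,dx=0,\qquad \text{(B)}\ \lim_{|x|\to\infty}\frac1{|B(x,|x|/2)|}\int_{B(x,|x|/2)}|u(y)-c|\,dy=0 . \] Moreover, (i), (ii) and each of the following four conditions are equivalent: for every $u\in\dot W^{1,p}(\mathbb R^d,w)$ there is a constant $\tilde d\in\mathbb R$ such that (S) holds with $\tilde d$ in place of $c$; the same with (A); the same with (B); for every $u\in\dot W^{1,p}(\mathbb R^d,w)$ there is a constant $\tilde d\in\mathbb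 R$ such that at least one of (S), (A), (B) holds with $\tilde d$ in place of $c$. -/

import Mathlib

open MeasureTheory Filter Topology
open scoped ENNReal NNReal ContDiff

noncomputable section

/-- The weighted Lebesgue measure `dμ = w dx` on `ℝ^d`. -/
def weightedMeasure {d : ℕ} (w : EuclideanSpace ℝ (Fin d) → ℝ) :
    Measure (EuclideanSpace ℝ (Fin d)) :=
  volume.withDensity fun x => ENNReal.ofReal (w x)

/-- The Muckenhoupt condition on balls, for `1 ≤ p < ∞`. All averages are `[0, ∞]`-valued, so
finiteness of the averages is part of the condition. -/
def MuckenhouptCondition {d : ℕ} (p : ℝ) (w : EuclideanSpace ℝ (Fin d) → ℝ) (C : ℝ≥0) : Prop :=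
  if p = 1 then
    ∀ (x : EuclideanSpace ℝ (Fin d)) (r : ℝ), 0 < r →
      ∀ᵐ y ∂(volume.restrict (Metric.ball x r)),
        (⨍⁻ z in Metric.ball x r, ENNReal.ofReal (w z) ∂volume) ≤ (C : ℝ≥0∞) * ENNReal.ofReal (w y)
  else
    ∀ (x : EuclideanSpace ℝ (Fin d)) (r : ℝ), 0 < r →
      (⨍⁻ z in Metric.ball x r, ENNReal.ofReal (w z) ∂volume) *
        (⨍⁻ z in Metric.ball x r, ENNReal.ofReal (w z) ^ (-(1 / (p - 1))) ∂volume) ^ (p - 1) ≤ (C : ℝ≥0∞)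

/-- The class `A_p(ℝ^d)` of Muckenhoupt weights (meant for `1 ≤ p < ∞`): nonnegative locally
integrable functions, positive almost everywhere, that satisfy the `A_p` condition. -/
structure IsMuckenhouptWeight {d : ℕ} (p : ℝ) (w : EuclideanSpace ℝ (Fin d) → ℝ) : Prop where
  locallyIntegrable : LocallyIntegrable w volume
  nonneg : ∀ x, 0 ≤ w x
  pos : ∀ᵐ x, 0 < w x
  condition : ∃ C : ℝ≥0, MuckenhouptCondition p w C

/-- `g` is the distributional gradient of `f`; both are locally integrable functions on `ℝ^d`. -/
structure IsWeakGradient {d : ℕ} (f : EuclideanSpace ℝ (Fin d) → ℝ)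
    (g : EuclideanSpace ℝ (Fin d) → EuclideanSpace ℝ (Fin d)) : Prop where
  locallyIntegrable_fun : LocallyIntegrable f volume
  locallyIntegrable_grad : LocallyIntegrable g volume
  integral_eq : ∀ φ : EuclideanSpace ℝ (Fin d) → ℝ, ContDiff ℝ ∞ φ → HasCompactSupport φ →
    ∀ i : Fin d, ∫ x, f x * fderiv ℝ φ x (EuclideanSpace.single i 1) = - ∫ x, g x i * φ x

/-- The Lebesgue representative `x ↦ limsup_{r → 0} ⨍_{B(x,r)} f dy`, with values in
`[-∞, ∞]`. -/
def lebesgueRep {d : ℕ} (f : EuclideanSpace ℝ (Fin d) → ℝ) (x : EuclideanSpace ℝ (Fin d)) :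
    EReal :=
  limsup (fun r : ℝ => ((⨍ y in Metric.ball x r, f y : ℝ) : EReal)) (𝓝[>] (0 : ℝ))

/-- The homogeneous weighted Sobolev space `Ẇ^{1,p}(ℝ^d, w)`: all Lebesgue representatives of
functions `f ∈ L^p_loc(ℝ^d, w)` whose distributional gradient belongs to `L^p(ℝ^d, w)`. -/
def homogeneousSobolev (d : ℕ) (p : ℝ) (w : EuclideanSpace ℝ (Fin d) → ℝ) :
    Set (EuclideanSpace ℝ (Fin d) → EReal) :=
  {u | ∃ (f : EuclideanSpace ℝ (Fin d) → ℝ)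
      (g : EuclideanSpace ℝ (Fin d) → EuclideanSpace ℝ (Fin d)),
    (∀ K : Set (EuclideanSpace ℝ (Fin d)), IsCompact K →
      MemLp f (ENNReal.ofReal p) ((weightedMeasure w).restrict K)) ∧
    IsWeakGradient f g ∧
    MemLp g (ENNReal.ofReal p) (weightedMeasure w) ∧
    u = lebesgueRep f}

/-- The unit sphere `𝕊^{d-1}`. -/
abbrev unitSphere (d : ℕ) : Set (EuclideanSpace ℝ (Fin d)) :=
  Metric.sphere (0 : EuclideanSpace ℝ (Fin d)) 1

/-- The surface measure on `𝕊^{d-1}`. -/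
def surfaceMeasure (d : ℕ) : Measure (unitSphere d) :=
  (volume : Measure (EuclideanSpace ℝ (Fin d))).toSphere

/-- There is a direction `ξ` with `liminf_{t → ∞} |u(tξ)| < ∞`. -/
def BoundedLiminfOnSomeRay {d : ℕ} (u : EuclideanSpace ℝ (Fin d) → EReal) : Prop :=
  ∃ ξ : unitSphere d,
    liminf (fun t : ℝ => (u (t • (ξ : EuclideanSpace ℝ (Fin d)))).abs) atTop < ⊤

/-- The real number `c` is the almost sure radial limit of `u`: `lim_{t → ∞} u(tξ) = c` for almost
every `ξ ∈ 𝕊^{d-1}`. -/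
def HasRadialLimit {d : ℕ} (u : EuclideanSpace ℝ (Fin d) → EReal) (c : ℝ) : Prop :=
  ∀ᵐ ξ : unitSphere d ∂(surfaceMeasure d),
    Tendsto (fun t : ℝ => u (t • (ξ : EuclideanSpace ℝ (Fin d)))) atTop (𝓝 (c : EReal))

/-- `lim_{r → ∞} ⨍_{𝕊^{d-1}} |u(rξ) - c| dσ(ξ) = 0`. -/
def HasSphericalMeanLimit {d : ℕ} (u : EuclideanSpace ℝ (Fin d) → EReal) (c : ℝ) : Prop :=
  Tendsto (fun r : ℝ =>
      ⨍⁻ ξ : unitSphere d, (u (r • (ξ : EuclideanSpace ℝ (Fin d))) - (c : EReal)).abs ∂(surfaceMeasure d))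
    atTop (𝓝 0)

/-- `lim_{t → ∞} ⨍_{B(0,t) ∖ B(0,t/2)} |u(x) - c| dx = 0`. -/
def HasAnnularMeanLimit {d : ℕ} (u : EuclideanSpace ℝ (Fin d) → EReal) (c : ℝ) : Prop :=
  Tendsto (fun t : ℝ =>
      ⨍⁻ x in Metric.ball (0 : EuclideanSpace ℝ (Fin d)) t \ Metric.ball 0 (t / 2),
        (u x - (c : EReal)).abs ∂volume)
    atTop (𝓝 0)

/-- `lim_{|x| → ∞} ⨍_{B(x,|x|/2)} |u(y) - c| dy = 0`. -/
def HasBallMeanLimit {d : ℕ} (u : EuclideanSpace ℝ (Fin d) → EReal) (c : ℝ) : Prop :=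
  Tendsto (fun x : EuclideanSpace ℝ (Fin d) =>
      ⨍⁻ y in Metric.ball x (‖x‖ / 2), (u y - (c : EReal)).abs ∂volume)
    (Bornology.cobounded (EuclideanSpace ℝ (Fin d))) (𝓝 0)

end

/-!
All six conditions are equivalent to one property of the weight, `RadiallySummable`: every
`G ∈ L^p(w)` satisfies `∫_{|y| ≥ 1} G(y) |y|^{1-d} dy < ∞`.

Suppose it holds, and let `f` have weak gradient `g ∈ L^p(w)`. Write
`Q_a(x) = ∫_a^∞ |g(s x)| |x| ds` for the tail of `|g|` along the ray through `x` (`rayTail`). Tonelli's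
theorem (`setLIntegral_rayTail_le`) shows that `Q_a` is locally integrable, so `Q_n → 0` almost
everywhere and in `L¹` on balls. Differentiating `b ↦ ∫ f(b x) φ(x) dx` gives
`f(b x) - f(a x) = ∫_a^b ⟨g(s x), x⟩ ds` for almost every `x`
(`IsWeakGradient.ae_sub_eq_integral_ray`), whence `|f(b x) - f(c x)| ≤ Q_a(x)` for `b, c ≥ a`.

The values of the Lebesgue representative `u` on a whole ray are controlled by averaging this
inequality: the mean of `f` over `B(b x, b r)` is the mean of `f(b ·)` over `B(x, r)`, so two such
means differ by at most the mean of `Q_a` over `B(x, r)`. At a common Lebesgue point `x` of `f` and of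
all `Q_n`, letting `r → 0` gives `|u(b x) - u(c x)| ≤ Q_n(x)` for all real `b, c ≥ n`. Hence `u` is
finite on the ray from `x` outwards, has a limit `c(x)` at infinity, and `|u(b x) - c(x)| ≤ Q_n(x)` for
`b ≥ n` (`IsWeakGradient.ae_exists_ray_limit`). The function `c` is the `L¹_loc` limit of `f(n ·)`, and
the gradients `n g(n ·)` tend to zero in `L¹_loc` because `d ≥ 2`; so `c` has zero weak gradient and is
constant (`IsWeakGradient.ae_eq_const`). The radial limit and the limits of the spherical, annular
and ball means follow from `|u(b x) - c| ≤ Q_n(x)` and `∫_{B(0,1)} Q_n → 0` by scaling.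

Suppose it fails for some `G`. Let `ρ(r) = r^{-d} ∫_{r < |y| < 2r} G`, with `G` cut off near the
origin, and `u(x) = ∫_0^{|x|} ρ`. The `A_p` condition, in the form of the weighted Jensen inequality
`IsMuckenhouptWeight.average_rpow_mul_le`, bounds the `L^p(w)` norm of `|∇u| = ρ(|x|)` by that of `G`,
while `∫_0^∞ ρ` is comparable to `∫ G |y|^{1-d} = ∞`. So `u` is a `C¹` element of the homogeneous
Sobolev space that tends to infinity, and it violates each of the conditions.
-/

/-! ### Integrals over dilations -/

theorem lintegral_comp_pos_smul {E : Type*} [NormedAddCommGroup E] [NormedSpace ℝ E]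
    [MeasurableSpace E] [BorelSpace E] [FiniteDimensional ℝ E] (μ : Measure E) [μ.IsAddHaarMeasure]
    (f : E → ℝ≥0∞) {r : ℝ} (hr : 0 < r) :
    ∫⁻ x, f (r • x) ∂μ = ENNReal.ofReal (r ^ Module.finrank ℝ E)⁻¹ * ∫⁻ x, f x ∂μ := by
  have h := Measure.map_addHaar_smul μ hr.ne'
  have h2 : ∫⁻ x, f x ∂(Measure.map (fun x => r • x) μ) = ∫⁻ x, f (r • x) ∂μ :=
    (Homeomorph.smulOfNeZero r hr.ne').measurableEmbedding.lintegral_map f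
  rw [← h2, h, lintegral_smul_measure, abs_of_pos (by positivity), smul_eq_mul]

theorem lintegral_Ioi_inv_pow_succ_le {n : ℕ} (hn : 1 ≤ n) {c : ℝ} (hc : 0 < c) :
    ∫⁻ s in Set.Ioi c, ENNReal.ofReal (s ^ (n + 1))⁻¹ ≤ ENNReal.ofReal (c ^ n)⁻¹ := by
  have hlt : (-(n + 1 : ℝ)) < -1 := by
    have : (1 : ℝ) ≤ n := by exact_mod_cast hn
    linarith
  have h1 : ∫⁻ s in Set.Ioi c, ENNReal.ofReal (s ^ (n + 1))⁻¹
      = ∫⁻ s in Set.Ioi c, ENNReal.ofReal (s ^ (-(n + 1 : ℝ))) := by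
    refine setLIntegral_congr_fun measurableSet_Ioi fun s hs => ?_
    have hs' : 0 < s := hc.trans hs
    rw [Real.rpow_neg hs'.le]
    norm_cast
  rw [h1, ← ofReal_integral_eq_lintegral_ofReal (integrableOn_Ioi_rpow_of_lt hlt hc)]
  · refine ENNReal.ofReal_le_ofReal ?_
    rw [integral_Ioi_rpow_of_lt hlt hc]
    have : (-(n + 1 : ℝ)) + 1 = -n := by ring
    rw [this, neg_div_neg_eq, Real.rpow_neg hc.le, Real.rpow_natCast]
    exact div_le_self (by positivity) (by exact_mod_cast hn)
  · filter_upwards [ae_restrict_mem measurableSet_Ioi] with s hs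
    have hs' : 0 < s := hc.trans hs
    positivity

/-- The kernel `max(1, |y|)^{1-n}`. In dimension `n` it dominates, up to a constant, the density that
appears when integrals along the outer parts of rays are averaged over a ball of base points; it
agrees with `|y|^{1-n}` away from the origin and is bounded near it. -/
noncomputable def radialKernel {E : Type*} [NormedAddCommGroup E] (n : ℕ) (y : E) : ℝ≥0∞ :=
  ENNReal.ofReal ((max 1 ‖y‖) ^ (n - 1))⁻¹

/-- The integral of `G` along the ray through `x`, from `a • x` to infinity. -/
noncomputable def rayTail {E : Type*} [NormedAddCommGroup E] [NormedSpace ℝ E]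
    (G : E → ℝ≥0∞) (a : ℝ) (x : E) : ℝ≥0∞ :=
  ∫⁻ s in Set.Ioi a, G (s • x) * ‖x‖ₑ

theorem measurable_radialKernel {E : Type*} [NormedAddCommGroup E] [MeasurableSpace E]
    [BorelSpace E] (n : ℕ) : Measurable (radialKernel (E := E) n) := by
  unfold radialKernel
  fun_prop

theorem rayTail_anti {E : Type*} [NormedAddCommGroup E] [NormedSpace ℝ E] (G : E → ℝ≥0∞) (x : E) :
    Antitone fun a => rayTail G a x :=
  fun _ _ hab => lintegral_mono_set (Set.Ioi_subset_Ioi hab)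

section
variable {E : Type*} [NormedAddCommGroup E] [NormedSpace ℝ E]
    [MeasurableSpace E] [BorelSpace E] [FiniteDimensional ℝ E]

theorem measurable_uncurry_ray {G : E → ℝ≥0∞} (hG : Measurable G) :
    Measurable fun q : ℝ × E => G (q.1 • q.2) * ‖q.2‖ₑ :=
  (hG.comp (measurable_fst.smul measurable_snd)).mul measurable_snd.enorm

theorem measurable_rayTail {G : E → ℝ≥0∞} (hG : Measurable G) (a : ℝ) :
    Measurable (rayTail G a) :=
  Measurable.lintegral_prod_left' (f := fun q : ℝ × E => G (q.1 • q.2) * ‖q.2‖ₑ)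
    (measurable_uncurry_ray hG)

/-- Polar coordinates in the form used here: the integral of the ray tails over a ball is bounded, up
to a constant, by the integral against `radialKernel`. -/
theorem setLIntegral_rayTail_le (μ : Measure E) [μ.IsAddHaarMeasure]
    (hn : 1 ≤ Module.finrank ℝ E) {G : E → ℝ≥0∞} (hG : Measurable G) {a R : ℝ}
    (ha : 0 < a) (hR : 0 < R) :
    ∫⁻ x in Metric.ball 0 R, rayTail G a x ∂μ ≤
      ENNReal.ofReal ((min a R⁻¹) ^ Module.finrank ℝ E)⁻¹ *
        ∫⁻ y, G y * radialKernel (Module.finrank ℝ E) y ∂μ := by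
  set n := Module.finrank ℝ E
  have hmeas := measurable_uncurry_ray hG
  unfold rayTail
  rw [lintegral_lintegral_swap (f := fun x s => G (s • x) * ‖x‖ₑ)
    (hmeas.comp measurable_swap).aemeasurable]
  have hinner : ∀ s ∈ Set.Ioi a, ∫⁻ x in Metric.ball 0 R, G (s • x) * ‖x‖ₑ ∂μ
      = ∫⁻ y, ENNReal.ofReal (s ^ (n + 1))⁻¹ *
        (Metric.ball (0 : E) (s * R)).indicator (fun y => G y * ‖y‖ₑ) y ∂μ := by
    intro s hs
    have hs : 0 < s := ha.trans hs
    have e1 : ∀ x, (Metric.ball (0 : E) R).indicator (fun x => G (s • x) * ‖x‖ₑ) x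
        = (fun y => ENNReal.ofReal s⁻¹ *
          (Metric.ball (0 : E) (s * R)).indicator (fun y => G y * ‖y‖ₑ) y) (s • x) := by
      intro x
      have hiff : s • x ∈ Metric.ball (0 : E) (s * R) ↔ x ∈ Metric.ball (0 : E) R := by
        simp [norm_smul, abs_of_pos hs, hs]
      by_cases hx : x ∈ Metric.ball (0 : E) R
      · simp only [Set.indicator_of_mem hx, Set.indicator_of_mem (hiff.2 hx)]
        rw [enorm_smul, mul_left_comm, ← mul_assoc (ENNReal.ofReal s⁻¹),
          Real.enorm_of_nonneg hs.le, ← ENNReal.ofReal_mul (by positivity),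
          inv_mul_cancel₀ hs.ne']
        simp
      · simp only [Set.indicator_of_notMem hx, Set.indicator_of_notMem (fun h => hx (hiff.1 h)),
          mul_zero]
    rw [← lintegral_indicator Metric.isOpen_ball.measurableSet]
    rw [lintegral_congr e1, lintegral_comp_pos_smul μ (fun y => ENNReal.ofReal s⁻¹ *
      (Metric.ball (0 : E) (s * R)).indicator (fun y => G y * ‖y‖ₑ) y) hs, ← lintegral_const_mul]
    · refine lintegral_congr fun y => ?_
      rw [← mul_assoc, ← ENNReal.ofReal_mul (by positivity)]
      congr 2
      rw [pow_succ, mul_inv]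
    · exact ((hG.mul measurable_enorm).indicator Metric.isOpen_ball.measurableSet).const_mul _
  rw [setLIntegral_congr_fun measurableSet_Ioi hinner, lintegral_lintegral_swap]
  · rw [← lintegral_const_mul _ (show Measurable fun y => G y * radialKernel n y from
      hG.mul (measurable_radialKernel n))]
    refine lintegral_mono fun y => ?_
    set m := max a (‖y‖ / R)
    have hmpos : 0 < m := lt_max_of_lt_left ha
    have hbound : ∫⁻ s in Set.Ioi a, ENNReal.ofReal (s ^ (n + 1))⁻¹ *
        (Metric.ball (0 : E) (s * R)).indicator (fun y => G y * ‖y‖ₑ) y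
        ≤ (∫⁻ s in Set.Ioi m, ENNReal.ofReal (s ^ (n + 1))⁻¹) * (G y * ‖y‖ₑ) := by
      rw [← lintegral_mul_const _ (by fun_prop), ← lintegral_indicator measurableSet_Ioi,
        ← lintegral_indicator measurableSet_Ioi]
      refine lintegral_mono fun s => ?_
      by_cases hs : s ∈ Set.Ioi m
      · have hsa : s ∈ Set.Ioi a := (le_max_left a _).trans_lt (Set.mem_Ioi.1 hs)
        simp only [Set.indicator_of_mem hs, Set.indicator_of_mem hsa]
        gcongr
        exact Set.indicator_le_self _ _ _
      · by_cases hsa : s ∈ Set.Ioi a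
        · have : y ∉ Metric.ball (0 : E) (s * R) := by
            intro hy
            apply hs
            simp only [mem_ball_zero_iff] at hy
            exact max_lt hsa ((div_lt_iff₀ hR).2 hy)
          simp [Set.indicator_of_mem hsa, Set.indicator_of_notMem this]
        · simp [Set.indicator_of_notMem hsa]
    refine hbound.trans ?_
    calc _ ≤ ENNReal.ofReal (m ^ n)⁻¹ * (G y * ‖y‖ₑ) := by
          gcongr
          exact lintegral_Ioi_inv_pow_succ_le hn hmpos
      _ = G y * (ENNReal.ofReal (m ^ n)⁻¹ * ENNReal.ofReal ‖y‖) := by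
          rw [ofReal_norm]; ring
      _ ≤ G y * (ENNReal.ofReal ((min a R⁻¹) ^ n)⁻¹ * radialKernel n y) := by
          refine mul_le_mul' le_rfl ?_
          unfold radialKernel
          rw [← ENNReal.ofReal_mul (by positivity), ← ENNReal.ofReal_mul (by positivity)]
          refine ENNReal.ofReal_le_ofReal ?_
          set δ := min a R⁻¹
          have hδ : 0 < δ := lt_min ha (by positivity)
          set M := max 1 ‖y‖
          have hM : 0 < M := by positivity
          have hle : δ * M ≤ m := by
            rcases max_cases 1 ‖y‖ with ⟨h, -⟩ | ⟨h, -⟩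
            · rw [show M = 1 from h, mul_one]
              exact (min_le_left _ _).trans (le_max_left _ _)
            · rw [show M = ‖y‖ from h]
              refine le_trans ?_ (le_max_right _ _)
              rw [div_eq_inv_mul]
              gcongr
              exact min_le_right _ _
          have hyM : ‖y‖ ≤ M := le_max_right _ _
          calc (m ^ n)⁻¹ * ‖y‖ ≤ ((δ * M) ^ n)⁻¹ * M := by gcongr
            _ = (δ ^ n)⁻¹ * (M ^ (n - 1))⁻¹ := by
                obtain ⟨k, hk⟩ : ∃ k, n = k + 1 := ⟨n - 1, by omega⟩
                rw [hk, Nat.add_sub_cancel]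
                field_simp
                ring
      _ = _ := by ring
  · have h1 : Measurable fun q : ℝ × E => ENNReal.ofReal (q.1 ^ (n + 1))⁻¹ := by fun_prop
    have h2 : MeasurableSet {q : ℝ × E | q.2 ∈ Metric.ball (0 : E) (q.1 * R)} := by
      simp only [mem_ball_zero_iff]
      exact measurableSet_lt (by fun_prop) (by fun_prop)
    have h3 : Measurable fun q : ℝ × E => G q.2 * ‖q.2‖ₑ :=
      (hG.comp measurable_snd).mul measurable_snd.enorm
    exact (h1.mul (h3.indicator h2)).aemeasurable

end

/-! ### Weak gradients and dilations -/

section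
variable {d : ℕ} {f : EuclideanSpace ℝ (Fin d) → ℝ}
  {g : EuclideanSpace ℝ (Fin d) → EuclideanSpace ℝ (Fin d)}

theorem MeasureTheory.LocallyIntegrable.integrable_mul_of_hasCompactSupport
    (hf : LocallyIntegrable f volume) {φ : EuclideanSpace ℝ (Fin d) → ℝ} (hφ : Continuous φ)
    (hc : HasCompactSupport φ) : Integrable (fun x => f x * φ x) :=
  hf.integrable_smul_right_of_hasCompactSupport hφ hc

theorem MeasureTheory.LocallyIntegrable.coord (hg : LocallyIntegrable g volume) (i : Fin d) :
    LocallyIntegrable (fun x => g x i) volume := fun x => by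
  obtain ⟨s, hs, h⟩ := hg x
  exact ⟨s, hs, (EuclideanSpace.proj (𝕜 := ℝ) i).integrable_comp h⟩

/-- The weak gradient tested against the vector field `y ↦ ψ(y) y`. -/
theorem IsWeakGradient.integral_euler (h : IsWeakGradient f g)
    {ψ : EuclideanSpace ℝ (Fin d) → ℝ} (hψ : ContDiff ℝ ∞ ψ) (hc : HasCompactSupport ψ) :
    ∫ y, f y * (d * ψ y + fderiv ℝ ψ y y) = - ∫ y, inner ℝ (g y) y * ψ y := by
  have hsm : ∀ i : Fin d, ContDiff ℝ ∞ fun y : EuclideanSpace ℝ (Fin d) => y i * ψ y :=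
    fun i => (EuclideanSpace.proj (𝕜 := ℝ) i).contDiff.mul hψ
  have hcs : ∀ i : Fin d, HasCompactSupport fun y : EuclideanSpace ℝ (Fin d) => y i * ψ y :=
    fun i => hc.mul_left
  have hfd : ∀ (i : Fin d) (y : EuclideanSpace ℝ (Fin d)),
      fderiv ℝ (fun y : EuclideanSpace ℝ (Fin d) => y i * ψ y) y (EuclideanSpace.single i 1)
        = ψ y + y i * fderiv ℝ ψ y (EuclideanSpace.single i 1) := by
    intro i y
    have h1 : HasFDerivAt (fun y : EuclideanSpace ℝ (Fin d) => y i)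
        (EuclideanSpace.proj (𝕜 := ℝ) i : EuclideanSpace ℝ (Fin d) →L[ℝ] ℝ) y :=
      (EuclideanSpace.proj (𝕜 := ℝ) i : EuclideanSpace ℝ (Fin d) →L[ℝ] ℝ).hasFDerivAt
    have h2 := h1.mul ((hψ.differentiable (by simp)) y).hasFDerivAt
    have h3 : fderiv ℝ (fun y : EuclideanSpace ℝ (Fin d) => y i * ψ y) y = _ := h2.fderiv
    rw [h3]
    simp
    ring
  have hdecomp : ∀ y : EuclideanSpace ℝ (Fin d), fderiv ℝ ψ y y
      = ∑ i, y i * fderiv ℝ ψ y (EuclideanSpace.single i 1) := by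
    intro y
    have hy : y = ∑ i, y i • EuclideanSpace.single i (1 : ℝ) := by
      have := (EuclideanSpace.basisFun (Fin d) ℝ).sum_repr y
      simpa using this.symm
    have h1 := congrArg (fderiv ℝ ψ y) hy
    rw [map_sum] at h1
    simpa only [map_smul, smul_eq_mul] using h1
  have hfdc : ∀ i : Fin d, Integrable fun y => f y *
      fderiv ℝ (fun y : EuclideanSpace ℝ (Fin d) => y i * ψ y) y (EuclideanSpace.single i 1) := by
    intro i
    refine LocallyIntegrable.integrable_mul_of_hasCompactSupport h.locallyIntegrable_fun ?_ ?_
    · exact ((hsm i).continuous_fderiv (by simp)).clm_apply continuous_const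
    · exact (hcs i).fderiv_apply ℝ _
  calc ∫ y, f y * (d * ψ y + fderiv ℝ ψ y y)
      = ∫ y, ∑ i, f y * fderiv ℝ (fun y : EuclideanSpace ℝ (Fin d) => y i * ψ y) y
          (EuclideanSpace.single i 1) := by
        refine integral_congr_ae (Eventually.of_forall fun y => ?_)
        simp only
        rw [← Finset.mul_sum, hdecomp]
        simp_rw [hfd]
        rw [Finset.sum_add_distrib]
        simp
    _ = ∑ i, - ∫ y, g y i * (y i * ψ y) := by
        rw [integral_finsetSum _ fun i _ => hfdc i]
        exact Finset.sum_congr rfl fun i _ => h.integral_eq _ (hsm i) (hcs i) i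
    _ = _ := by
        rw [Finset.sum_neg_distrib, ← integral_finsetSum]
        · congr 2
          ext y
          simp_rw [PiLp.inner_apply, Finset.sum_mul]
          refine Finset.sum_congr rfl fun i _ => ?_
          simp
          ring
        · intro i _
          exact LocallyIntegrable.integrable_mul_of_hasCompactSupport
            (LocallyIntegrable.coord h.locallyIntegrable_grad i) (hsm i).continuous (hcs i)

theorem HasCompactSupport.comp_pos_smul {φ : EuclideanSpace ℝ (Fin d) → ℝ}
    (hc : HasCompactSupport φ) {m : ℝ} (hm : 0 < m) : HasCompactSupport fun y => φ (m • y) :=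
  hc.comp_homeomorph (Homeomorph.smulOfNeZero m hm.ne')

/-- Differentiating `φ(m y)` in `m` produces the Euler field, so the derivative of the rescaled
pairing is computed by `IsWeakGradient.integral_euler`. -/
theorem IsWeakGradient.hasDerivAt_scaled_integral (h : IsWeakGradient f g)
    {φ : EuclideanSpace ℝ (Fin d) → ℝ} (hφ : ContDiff ℝ ∞ φ) (hc : HasCompactSupport φ)
    {m : ℝ} (hm : 0 < m) :
    HasDerivAt (fun m : ℝ => m ^ d * ∫ y, f y * φ (m • y))
      (-(m ^ d * m⁻¹) * ∫ y, inner ℝ (g y) y * φ (m • y)) m := by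
  obtain ⟨R, hR⟩ := hc.isCompact.isBounded.subset_closedBall 0
  have hd1 : Continuous (fderiv ℝ φ) := hφ.continuous_fderiv (by simp)
  obtain ⟨C, hC⟩ := (hc.fderiv ℝ).exists_bound_of_continuous hd1
  set K : Set (EuclideanSpace ℝ (Fin d)) := Metric.closedBall 0 (2 * R / m)
  have hfK : IntegrableOn f K := h.locallyIntegrable_fun.integrableOn_isCompact
    (isCompact_closedBall _ _)
  have hder : HasDerivAt (fun m : ℝ => ∫ y, f y * φ (m • y))
      (∫ y, f y * fderiv ℝ φ (m • y) y) m := by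
    refine (hasDerivAt_integral_of_dominated_loc_of_deriv_le
      (F := fun m y => f y * φ (m • y)) (F' := fun m y => f y * fderiv ℝ φ (m • y) y)
      (bound := K.indicator fun y => ‖f y‖ * (C * (2 * R / m)))
      (s := Set.Ioi (m / 2)) (Ioi_mem_nhds (by linarith)) ?_ ?_ ?_ ?_ ?_ ?_).2
    · filter_upwards with k
      exact h.locallyIntegrable_fun.aestronglyMeasurable.mul
        (hφ.continuous.comp (continuous_const_smul k)).aestronglyMeasurable
    · exact LocallyIntegrable.integrable_mul_of_hasCompactSupport h.locallyIntegrable_fun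
        (hφ.continuous.comp (continuous_const_smul m)) (hc.comp_pos_smul hm)
    · exact h.locallyIntegrable_fun.aestronglyMeasurable.mul
        ((hd1.comp (continuous_const_smul m)).clm_apply continuous_id).aestronglyMeasurable
    · filter_upwards with y k hk
      have hk' : m / 2 < k := hk
      have hkpos : 0 < k := by linarith
      by_cases hy : y ∈ K
      · rw [Set.indicator_of_mem hy, norm_mul]
        have : ‖y‖ ≤ 2 * R / m := by simpa [K] using hy
        gcongr
        exact (ContinuousLinearMap.le_opNorm _ _).trans
          (mul_le_mul (hC _) this (norm_nonneg _) ((norm_nonneg _).trans (hC 0)))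
      · rw [Set.indicator_of_notMem hy]
        have : fderiv ℝ φ (k • y) = 0 := by
          apply image_eq_zero_of_notMem_tsupport
          intro hmem
          have h1 := hR (tsupport_fderiv_subset ℝ hmem)
          rw [mem_closedBall_zero_iff, norm_smul, Real.norm_of_nonneg hkpos.le] at h1
          apply hy
          rw [mem_closedBall_zero_iff, le_div_iff₀ hm]
          nlinarith [norm_nonneg y]
        simp [this]
    · rw [integrable_indicator_iff Metric.isClosed_closedBall.measurableSet]
      exact hfK.norm.mul_const _
    · filter_upwards with y k _
      have h1 : HasDerivAt (fun k : ℝ => k • y) y k := by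
        simpa using (hasDerivAt_id k).smul_const y
      have h2 := ((hφ.differentiable (by simp)) (k • y)).hasFDerivAt.comp_hasDerivAt k h1
      exact h2.const_mul _
  have hpow := hasDerivAt_pow d m
  refine (hpow.mul hder).congr_deriv ?_
  have heul := h.integral_euler (hφ.comp (contDiff_const_smul m)) (hc.comp_pos_smul hm)
  have hfd : ∀ y, fderiv ℝ (φ ∘ fun y => m • y) y y = m * fderiv ℝ φ (m • y) y := by
    intro y
    rw [fderiv_comp y ((hφ.differentiable (by simp)) _) (by fun_prop)]
    have : fderiv ℝ (fun y : EuclideanSpace ℝ (Fin d) => m • y) y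
        = m • ContinuousLinearMap.id ℝ _ :=
      ((hasFDerivAt_id y).const_smul m).fderiv
    simp [this]
  simp_rw [hfd] at heul
  have hi1 : Integrable fun y => f y * φ (m • y) :=
    LocallyIntegrable.integrable_mul_of_hasCompactSupport h.locallyIntegrable_fun
        (hφ.continuous.comp (continuous_const_smul m)) (hc.comp_pos_smul hm)
  have hi2 : Integrable fun y => f y * fderiv ℝ φ (m • y) y := by
    refine LocallyIntegrable.integrable_mul_of_hasCompactSupport h.locallyIntegrable_fun
      ((hd1.comp (continuous_const_smul m)).clm_apply continuous_id) ?_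
    refine ((hc.fderiv ℝ).comp_homeomorph (Homeomorph.smulOfNeZero m hm.ne')).mono ?_
    intro y hy
    simp only [Function.mem_support] at hy ⊢
    intro h0
    apply hy
    have : fderiv ℝ φ (m • y) = 0 := h0
    simp [this]
  have hsplit : ∫ y, f y * (d * φ (m • y) + m * fderiv ℝ φ (m • y) y)
      = d * (∫ y, f y * φ (m • y)) + m * ∫ y, f y * fderiv ℝ φ (m • y) y := by
    rw [← integral_const_mul, ← integral_const_mul, ← integral_add (hi1.const_mul _)
      (hi2.const_mul _)]
    congr 1
    ext y
    ring
  simp only [Function.comp_def] at heul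
  rw [hsplit] at heul
  have : ∫ y, inner ℝ (g y) y * φ (m • y) = -(d * (∫ y, f y * φ (m • y)) +
      m * ∫ y, f y * fderiv ℝ φ (m • y) y) := by rw [heul, neg_neg]
  rw [this]
  rcases Nat.eq_zero_or_pos d with hd0 | hd0
  · subst hd0
    field_simp
    simp
  · obtain ⟨k, rfl⟩ : ∃ k, d = k + 1 := ⟨d - 1, by omega⟩
    field_simp
    simp
    ring

/-- The derivative of `b ↦ ∫ f(b x) φ(x) dx` is the pairing of `φ` with the derivative of `f` along
the rays from the origin. -/
theorem IsWeakGradient.hasDerivAt_integral_dilation (h : IsWeakGradient f g)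
    {φ : EuclideanSpace ℝ (Fin d) → ℝ} (hφ : ContDiff ℝ ∞ φ) (hc : HasCompactSupport φ)
    {b : ℝ} (hb : 0 < b) :
    HasDerivAt (fun b : ℝ => ∫ x, f (b • x) * φ x)
      (∫ x, inner ℝ (g (b • x)) x * φ x) b := by
  have hinv : HasDerivAt (fun b : ℝ => b⁻¹) (-(b ^ 2)⁻¹) b := hasDerivAt_inv hb.ne'
  have h1 := (h.hasDerivAt_scaled_integral hφ hc (inv_pos.2 hb)).comp b hinv
  have hscale : ∀ (F : EuclideanSpace ℝ (Fin d) → ℝ) (b : ℝ), 0 < b →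
      ∫ x, F (b • x) = (b⁻¹) ^ d * ∫ x, F x := by
    intro F b hb
    rw [Measure.integral_comp_smul, abs_of_pos (by positivity)]
    simp
  have heq : (fun b : ℝ => ∫ x, f (b • x) * φ x) =ᶠ[𝓝 b]
      (fun m : ℝ => m ^ d * ∫ y, f y * φ (m • y)) ∘ fun b : ℝ => b⁻¹ := by
    filter_upwards [Ioi_mem_nhds hb] with b (hb : 0 < b)
    simp only [Function.comp_apply]
    rw [← hscale (fun y => f y * φ (b⁻¹ • y)) b hb]
    simp [smul_smul, inv_mul_cancel₀ hb.ne']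
  refine (h1.congr_of_eventuallyEq heq).congr_deriv ?_
  have h2 := hscale (fun y => inner ℝ (g y) (b⁻¹ • y) * φ (b⁻¹ • y)) b hb
  simp only [smul_smul, inv_mul_cancel₀ hb.ne', one_smul] at h2
  rw [h2]
  simp_rw [inner_smul_right, mul_assoc, integral_const_mul]
  field_simp

end

/-! ### Oscillation along rays -/

theorem enorm_inner_le_mul {E : Type*} [NormedAddCommGroup E] [InnerProductSpace ℝ E] (x y : E) :
    ‖inner ℝ x y‖ₑ ≤ ‖x‖ₑ * ‖y‖ₑ := by
  rw [enorm_eq_nnnorm, enorm_eq_nnnorm, enorm_eq_nnnorm]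
  exact_mod_cast nnnorm_inner_le_nnnorm (𝕜 := ℝ) x y

section
variable {d : ℕ} {f : EuclideanSpace ℝ (Fin d) → ℝ}
  {g : EuclideanSpace ℝ (Fin d) → EuclideanSpace ℝ (Fin d)}

theorem setLIntegral_rayTail_lt_top (hd : 1 ≤ d) (hg : Measurable g)
    (hK : ∫⁻ y, ‖g y‖ₑ * radialKernel d y < ⊤) {a R : ℝ} (ha : 0 < a) (hR : 0 < R) :
    ∫⁻ x in Metric.ball 0 R, rayTail (fun y => ‖g y‖ₑ) a x < ⊤ := by
  have h := setLIntegral_rayTail_le (volume : Measure (EuclideanSpace ℝ (Fin d)))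
    (by simpa using hd) hg.enorm ha hR
  simp only [finrank_euclideanSpace, Fintype.card_fin] at h
  exact h.trans_lt (ENNReal.mul_lt_top ENNReal.ofReal_lt_top hK)

theorem integrable_uncurry_ray (hd : 1 ≤ d) (hg : Measurable g)
    (hK : ∫⁻ y, ‖g y‖ₑ * radialKernel d y < ⊤) {a R : ℝ} (ha : 0 < a) (hR : 0 < R) :
    Integrable (fun q : ℝ × EuclideanSpace ℝ (Fin d) => inner ℝ (g (q.1 • q.2)) q.2)
      ((volume.restrict (Set.Ioi a)).prod (volume.restrict (Metric.ball 0 R))) := by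
  have hm : Measurable fun q : ℝ × EuclideanSpace ℝ (Fin d) => inner ℝ (g (q.1 • q.2)) q.2 :=
    (hg.comp (measurable_fst.smul measurable_snd)).inner measurable_snd
  refine ⟨hm.aestronglyMeasurable, ?_⟩
  rw [HasFiniteIntegral, lintegral_prod_symm _ hm.enorm.aemeasurable]
  refine lt_of_le_of_lt ?_ (setLIntegral_rayTail_lt_top hd hg hK ha hR)
  refine lintegral_mono fun x => lintegral_mono fun s => ?_
  simpa using enorm_inner_le_mul (g (s • x)) x

theorem locallyIntegrable_of_integrableOn_ball {V : Type*} [NormedAddCommGroup V]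
    {F : EuclideanSpace ℝ (Fin d) → V}
    (h : ∀ R : ℝ, 0 < R → IntegrableOn F (Metric.ball 0 R)) : LocallyIntegrable F volume :=
  fun x => ⟨Metric.ball 0 (‖x‖ + 1), Metric.isOpen_ball.mem_nhds (by simp),
    h _ (by positivity)⟩

theorem MeasureTheory.LocallyIntegrable.comp_pos_smul {V : Type*} [NormedAddCommGroup V]
    {f : EuclideanSpace ℝ (Fin d) → V} (hf : LocallyIntegrable f volume) {c : ℝ} (hc : 0 < c) :
    LocallyIntegrable (fun x => f (c • x)) volume := by
  refine locallyIntegrable_of_integrableOn_ball fun R hR => ?_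
  have h1 : IntegrableOn f (Metric.ball 0 (c * R)) :=
    (hf.integrableOn_isCompact (isCompact_closedBall 0 (c * R))).mono_set
      Metric.ball_subset_closedBall
  rw [← integrable_indicator_iff Metric.isOpen_ball.measurableSet] at h1 ⊢
  refine (h1.comp_smul hc.ne').congr (Eventually.of_forall fun x => ?_)
  simp only [Set.indicator, mem_ball_zero_iff, norm_smul, Real.norm_of_nonneg hc.le]
  simp [hc]

theorem locallyIntegrable_rayTail (hd : 1 ≤ d) (hg : Measurable g)
    (hK : ∫⁻ y, ‖g y‖ₑ * radialKernel d y < ⊤) {a : ℝ} (ha : 0 < a) :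
    LocallyIntegrable (fun x => (rayTail (fun y => ‖g y‖ₑ) a x).toReal) volume :=
  locallyIntegrable_of_integrableOn_ball fun _ hR =>
    integrable_toReal_of_lintegral_ne_top (measurable_rayTail hg.enorm a).aemeasurable
      (setLIntegral_rayTail_lt_top hd hg hK ha hR).ne

theorem tendsto_rayTail_zero {G : EuclideanSpace ℝ (Fin d) → ℝ≥0∞} (hG : Measurable G)
    {x : EuclideanSpace ℝ (Fin d)} (hx : rayTail G 1 x < ⊤) :
    Tendsto (fun n : ℕ => rayTail G n x) atTop (𝓝 0) := by
  have hm : Measurable fun s : ℝ => G (s • x) * ‖x‖ₑ :=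
    (hG.comp (measurable_id.smul_const x)).mul_const _
  have hdom := tendsto_lintegral_filter_of_dominated_convergence (μ := volume) (l := atTop)
    (F := fun (n : ℕ) => (Set.Ioi (n : ℝ)).indicator fun s => G (s • x) * ‖x‖ₑ)
    (f := fun _ => 0) ((Set.Ioi (1 : ℝ)).indicator fun s => G (s • x) * ‖x‖ₑ)
    (Eventually.of_forall fun n => hm.indicator measurableSet_Ioi)
    (by
      filter_upwards [eventually_ge_atTop 1] with n hn
      refine Eventually.of_forall fun s => ?_
      exact Set.indicator_le_indicator_of_subset
        (Set.Ioi_subset_Ioi (by exact_mod_cast hn)) (fun _ => zero_le) s)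
    (by rw [lintegral_indicator measurableSet_Ioi]; exact hx.ne)
    (Eventually.of_forall fun s => by
      refine tendsto_const_nhds.congr' ?_
      obtain ⟨N, hN⟩ := exists_nat_ge s
      filter_upwards [eventually_ge_atTop N] with n hn
      rw [Set.indicator_of_notMem]
      simpa using hN.trans (by exact_mod_cast hn))
  simpa [rayTail, lintegral_indicator measurableSet_Ioi] using hdom

theorem ae_rayTail_lt_top (hd : 1 ≤ d) (hg : Measurable g)
    (hK : ∫⁻ y, ‖g y‖ₑ * radialKernel d y < ⊤) {a : ℝ} (ha : 0 < a) :
    ∀ᵐ x, rayTail (fun y => ‖g y‖ₑ) a x < ⊤ := by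
  have h : ∀ n : ℕ, ∀ᵐ x, x ∈ Metric.ball (0 : EuclideanSpace ℝ (Fin d)) (n + 1) →
      rayTail (fun y => ‖g y‖ₑ) a x < ⊤ := fun n =>
    (ae_restrict_iff' Metric.isOpen_ball.measurableSet).1
      (ae_lt_top (measurable_rayTail hg.enorm a)
        (setLIntegral_rayTail_lt_top hd hg hK ha (by positivity)).ne)
  filter_upwards [ae_all_iff.2 h] with x hx
  obtain ⟨n, hn⟩ := exists_nat_gt ‖x‖
  exact hx n (by rw [mem_ball_zero_iff]; linarith)

/-- A function with a weak gradient is, in the integrated sense, absolutely continuous along almost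
every ray. -/
theorem IsWeakGradient.ae_sub_eq_integral_ray (h : IsWeakGradient f g) (hd : 1 ≤ d)
    (hg : Measurable g) (hK : ∫⁻ y, ‖g y‖ₑ * radialKernel d y < ⊤) {a b : ℝ} (ha : 0 < a)
    (hab : a ≤ b) :
    ∀ᵐ x, f (b • x) - f (a • x) = ∫ s in a..b, inner ℝ (g (s • x)) x := by
  have hb : 0 < b := ha.trans_le hab
  have hint : ∀ R : ℝ, 0 < R →
      Integrable (fun q : ℝ × EuclideanSpace ℝ (Fin d) => inner ℝ (g (q.1 • q.2)) q.2)
        ((volume.restrict (Set.uIoc a b)).prod (volume.restrict (Metric.ball 0 R))) := by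
    intro R hR
    refine (integrable_uncurry_ray hd hg hK ha hR).mono_measure ?_
    refine Measure.prod_mono (Measure.restrict_mono ?_ le_rfl) le_rfl
    rw [Set.uIoc_of_le hab]
    exact Set.Ioc_subset_Ioi_self
  have hfl : ∀ c : ℝ, 0 < c → LocallyIntegrable (fun x => f (c • x)) volume :=
    fun c hc => LocallyIntegrable.comp_pos_smul h.locallyIntegrable_fun hc
  have hSl : LocallyIntegrable (fun x => ∫ s in a..b, inner ℝ (g (s • x)) x) volume := by
    refine locallyIntegrable_of_integrableOn_ball fun R hR => ?_
    have := (hint R hR).integral_prod_right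
    simpa only [IntegrableOn, intervalIntegral.integral_of_le hab, Set.uIoc_of_le hab] using this
  have hloc := ((hfl b hb).sub (hfl a ha)).sub hSl
  have key := ae_eq_zero_of_integral_contDiff_smul_eq_zero hloc ?_
  · filter_upwards [key] with x hx
    exact sub_eq_zero.1 hx
  intro φ hφ hc
  obtain ⟨R0, hR0⟩ := hc.isCompact.isBounded.subset_ball 0
  set R := max R0 1
  have hR : 0 < R := by positivity
  have hsupp : tsupport φ ⊆ Metric.ball 0 R :=
    hR0.trans (Metric.ball_subset_ball (le_max_left _ _))
  obtain ⟨C, hC⟩ := hc.exists_bound_of_continuous hφ.continuous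
  have hres : ∀ F : EuclideanSpace ℝ (Fin d) → ℝ,
      ∫ x, F x * φ x = ∫ x in Metric.ball 0 R, F x * φ x := by
    intro F
    refine (setIntegral_eq_integral_of_forall_compl_eq_zero fun x hx => ?_).symm
    rw [image_eq_zero_of_notMem_tsupport fun h' => hx (hsupp h'), mul_zero]
  have hintφ : Integrable
      (fun q : ℝ × EuclideanSpace ℝ (Fin d) => inner ℝ (g (q.1 • q.2)) q.2 * φ q.2)
        ((volume.restrict (Set.uIoc a b)).prod (volume.restrict (Metric.ball 0 R))) :=
    (hint R hR).mul_bdd (c := C) (hφ.continuous.comp continuous_snd).aestronglyMeasurable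
      (Eventually.of_forall fun q => hC q.2)
  -- Both sides are paired with `φ`: integrate the derivative of the dilated pairing, use Fubini.
  have hftc := intervalIntegral.integral_eq_sub_of_hasDerivAt
    (f := fun b : ℝ => ∫ x, f (b • x) * φ x)
    (f' := fun b : ℝ => ∫ x, inner ℝ (g (b • x)) x * φ x) (a := a) (b := b)
    (fun s hs => h.hasDerivAt_integral_dilation hφ hc (ha.trans_le (by
      rw [Set.uIcc_of_le hab] at hs; exact hs.1))) (by
      rw [intervalIntegrable_iff]
      simp_rw [hres]
      exact hintφ.integral_prod_left)
  have hswap := intervalIntegral_integral_swap (a := a) (b := b)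
    (μ := volume.restrict (Metric.ball (0 : EuclideanSpace ℝ (Fin d)) R))
    (f := fun s x => inner ℝ (g (s • x)) x * φ x) hintφ
  simp_rw [hres] at hftc
  rw [hswap] at hftc
  have hi : ∀ F : EuclideanSpace ℝ (Fin d) → ℝ, LocallyIntegrable F volume →
      Integrable fun x => F x * φ x := fun F hF =>
    LocallyIntegrable.integrable_mul_of_hasCompactSupport hF hφ.continuous hc
  have e1 : ∫ x, φ x • ((fun x => f (b • x)) - (fun x => f (a • x)) -
        fun x => ∫ s in a..b, inner ℝ (g (s • x)) x) x
      = (∫ x, f (b • x) * φ x) - (∫ x, f (a • x) * φ x) -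
        ∫ x, (∫ s in a..b, inner ℝ (g (s • x)) x) * φ x := by
    have h1 := integral_sub (hi _ (hfl b hb)) (hi _ (hfl a ha))
    have h2 := integral_sub ((hi _ (hfl b hb)).sub (hi _ (hfl a ha))) (hi _ hSl)
    simp only [Pi.sub_apply] at h2
    rw [← h1, ← h2]
    congr 1
    ext x
    simp
    ring
  rw [e1]
  simp_rw [hres, ← intervalIntegral.integral_mul_const]
  rw [hftc]
  ring

theorem IsWeakGradient.ae_enorm_sub_le_rayTail (h : IsWeakGradient f g) (hd : 1 ≤ d)
    (hg : Measurable g) (hK : ∫⁻ y, ‖g y‖ₑ * radialKernel d y < ⊤) {a b c : ℝ} (ha : 0 < a)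
    (hab : a ≤ b) (hac : a ≤ c) :
    ∀ᵐ x, ‖f (b • x) - f (c • x)‖ₑ ≤ rayTail (fun y => ‖g y‖ₑ) a x := by
  wlog hcb : c ≤ b generalizing b c
  · filter_upwards [this hac hab (le_of_not_ge hcb)] with x hx
    rwa [← neg_sub, enorm_neg]
  filter_upwards [h.ae_sub_eq_integral_ray hd hg hK (ha.trans_le hac) hcb] with x hx
  rw [hx, intervalIntegral.integral_of_le hcb]
  refine (enorm_integral_le_lintegral_enorm _).trans ?_
  refine (lintegral_mono fun s => enorm_inner_le_mul (g (s • x)) x).trans ?_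
  exact lintegral_mono_set (Set.Ioc_subset_Ioi_self.trans (Set.Ioi_subset_Ioi hac))

/-- Lebesgue's differentiation theorem for open balls. -/
theorem ae_tendsto_average_ball {F : EuclideanSpace ℝ (Fin d) → ℝ}
    (hF : LocallyIntegrable F volume) :
    ∀ᵐ x, Tendsto (fun r : ℝ => ⨍ y in Metric.ball x r, F y) (𝓝[>] 0) (𝓝 (F x)) := by
  filter_upwards [IsUnifLocDoublingMeasure.ae_tendsto_average volume hF 1] with x hx
  have h1 := hx (l := 𝓝[>] (0 : ℝ)) (fun _ => x) (fun r => r) tendsto_id (by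
    filter_upwards [self_mem_nhdsWithin] with r (hr : 0 < r)
    simpa using hr.le)
  refine h1.congr' ?_
  filter_upwards [self_mem_nhdsWithin] with r (hr : 0 < r)
  refine setAverage_congr ?_
  exact (Metric.ball_subset_closedBall.eventuallyLE.antisymm
    (by
      have : volume (Metric.closedBall x r \ Metric.ball x r) = 0 := by
        rw [Metric.closedBall_sdiff_ball]
        exact Measure.addHaar_sphere_of_ne_zero _ _ hr.ne'
      exact ae_le_set.2 this)).symm

open scoped Pointwise in
theorem average_ball_smul (F : EuclideanSpace ℝ (Fin d) → ℝ) (x : EuclideanSpace ℝ (Fin d))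
    {b : ℝ} (hb : 0 < b) (r : ℝ) :
    ⨍ y in Metric.ball (b • x) (b * r), F y = ⨍ y in Metric.ball x r, F (b • y) := by
  have hball : Metric.ball (b • x) (b * r) = b • Metric.ball x r := by
    rw [smul_ball hb.ne', Real.norm_of_nonneg hb.le]
  rw [setAverage_eq, setAverage_eq, Measure.setIntegral_comp_smul_of_pos _ _ _ hb, hball,
    Measure.real, Measure.real, Measure.addHaar_smul, ENNReal.toReal_mul,
    ENNReal.toReal_ofReal (abs_nonneg _), abs_of_pos (by positivity),
    mul_inv, smul_smul, finrank_euclideanSpace, Fintype.card_fin, mul_comm]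

theorem lebesgueRep_eq_of_tendsto {x : EuclideanSpace ℝ (Fin d)} {a : ℝ}
    (h : Tendsto (fun r : ℝ => ⨍ y in Metric.ball x r, f y) (𝓝[>] 0) (𝓝 a)) :
    lebesgueRep f x = a :=
  ((continuous_coe_real_ereal.tendsto a).comp h).limsup_eq

theorem lebesgueRep_ae_eq (hf : LocallyIntegrable f volume) :
    ∀ᵐ x, lebesgueRep f x = f x := by
  filter_upwards [ae_tendsto_average_ball hf] with x hx
  exact lebesgueRep_eq_of_tendsto hx

theorem lebesgueRep_smul (x : EuclideanSpace ℝ (Fin d)) {b : ℝ} (hb : 0 < b) :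
    lebesgueRep f (b • x) =
      limsup (fun r : ℝ => ((⨍ y in Metric.ball x r, f (b • y) : ℝ) : EReal)) (𝓝[>] 0) := by
  have hmap : map (fun r : ℝ => b * r) (𝓝[>] 0) = 𝓝[>] 0 := by
    have := (Homeomorph.mulLeft₀ b hb.ne').isEmbedding.map_nhdsWithin_eq (Set.Ioi 0) 0
    simpa [Set.image_mul_left_Ioi hb] using this
  unfold lebesgueRep
  conv_lhs => rw [← hmap]
  rw [← limsup_comp]
  simp only [Function.comp_def, average_ball_smul f x hb]

/-- At a Lebesgue point of `f` and of the ray tails, the Lebesgue representative of `f` is finite on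
the ray through that point, with oscillation controlled by the ray tails. -/
theorem IsWeakGradient.lebesgueRep_smul_le (h : IsWeakGradient f g) (hd : 1 ≤ d)
    (hg : Measurable g) (hK : ∫⁻ y, ‖g y‖ₑ * radialKernel d y < ⊤) {a b c : ℝ} (ha : 0 < a)
    (hab : a ≤ b) (hac : a ≤ c) {x : EuclideanSpace ℝ (Fin d)}
    (hx : Tendsto (fun r : ℝ => ⨍ y in Metric.ball x r, (rayTail (fun y => ‖g y‖ₑ) a y).toReal)
      (𝓝[>] 0) (𝓝 (rayTail (fun y => ‖g y‖ₑ) a x).toReal)) :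
    lebesgueRep f (b • x) ≤
      lebesgueRep f (c • x) + ((rayTail (fun y => ‖g y‖ₑ) a x).toReal : EReal) := by
  rw [lebesgueRep_smul x (ha.trans_le hab), lebesgueRep_smul x (ha.trans_le hac)]
  have hlim := ((continuous_coe_real_ereal.tendsto _).comp hx).limsup_eq
  rw [← hlim]
  refine le_trans ?_ (EReal.limsup_add_le (Or.inr ?_) (Or.inr ?_))
  · refine limsup_le_limsup ?_
    filter_upwards [self_mem_nhdsWithin] with r (hr : 0 < r)
    simp only [Pi.add_apply, Function.comp_apply]
    rw [← EReal.coe_add, EReal.coe_le_coe_iff, setAverage_eq, setAverage_eq, setAverage_eq,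
      ← smul_add]
    have hI : ∀ F : EuclideanSpace ℝ (Fin d) → ℝ, LocallyIntegrable F volume →
        IntegrableOn F (Metric.ball x r) := fun F hF =>
      (hF.integrableOn_isCompact (isCompact_closedBall x r)).mono_set Metric.ball_subset_closedBall
    have hfc := hI _ (LocallyIntegrable.comp_pos_smul h.locallyIntegrable_fun (ha.trans_le hac))
    have hfb := hI _ (LocallyIntegrable.comp_pos_smul h.locallyIntegrable_fun (ha.trans_le hab))
    have hq := hI _ (locallyIntegrable_rayTail hd hg hK ha)
    rw [← integral_add hfc hq]
    refine smul_le_smul_of_nonneg_left (integral_mono_ae hfb (hfc.add hq) ?_) (by positivity)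
    refine ae_restrict_of_ae ?_
    filter_upwards [h.ae_enorm_sub_le_rayTail hd hg hK ha hab hac, ae_rayTail_lt_top hd hg hK ha]
      with y hy hy'
    have h1 := ENNReal.toReal_mono hy'.ne hy
    rw [toReal_enorm, Real.norm_eq_abs] at h1
    have := le_abs_self (f (b • y) - f (c • y))
    linarith
  · rw [hlim]; exact EReal.coe_ne_top _
  · rw [hlim]; exact EReal.coe_ne_bot _


/-- Along almost every ray the Lebesgue representative of `f` is finite beyond the base point and
converges at infinity, at a rate controlled by the ray tails. -/
theorem IsWeakGradient.ae_exists_ray_limit (h : IsWeakGradient f g) (hd : 1 ≤ d)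
    (hg : Measurable g) (hK : ∫⁻ y, ‖g y‖ₑ * radialKernel d y < ⊤) :
    ∀ᵐ x, ∃ c : ℝ, ∀ n : ℕ, 1 ≤ n → ∀ b : ℝ, n ≤ b → ∃ v : ℝ, lebesgueRep f (b • x) = v ∧
      |v - c| ≤ (rayTail (fun y => ‖g y‖ₑ) n x).toReal := by
  set Q : ℕ → EuclideanSpace ℝ (Fin d) → ℝ := fun n x => (rayTail (fun y => ‖g y‖ₑ) n x).toReal
  have hleb : ∀ n : ℕ, ∀ᵐ x, 1 ≤ n → Tendsto (fun r : ℝ => ⨍ y in Metric.ball x r, Q n y)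
      (𝓝[>] 0) (𝓝 (Q n x)) := by
    intro n
    by_cases hn : 1 ≤ n
    · filter_upwards [ae_tendsto_average_ball (locallyIntegrable_rayTail hd hg hK
        (show (0 : ℝ) < n by exact_mod_cast hn))] with x hx _
      exact hx
    · exact Eventually.of_forall fun x hn' => absurd hn' hn
  filter_upwards [ae_all_iff.2 hleb, lebesgueRep_ae_eq h.locallyIntegrable_fun,
    ae_rayTail_lt_top hd hg hK one_pos] with x hx hfx hfin
  have hle : ∀ n : ℕ, 1 ≤ n → ∀ b c : ℝ, n ≤ b → n ≤ c →
      lebesgueRep f (b • x) ≤ lebesgueRep f (c • x) + (Q n x : EReal) := by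
    intro n hn b c hb hc
    exact h.lebesgueRep_smul_le hd hg hK (by exact_mod_cast hn) hb hc (hx n hn)
  -- Comparison with the base point `b = 1`, where the value is `f x`, rules out infinite values.
  have hreal : ∀ b : ℝ, 1 ≤ b → ∃ v : ℝ, lebesgueRep f (b • x) = v := by
    intro b hb
    have h1 := hle 1 le_rfl b 1 (by simpa using hb) (by simp)
    have h2 := hle 1 le_rfl 1 b (by simp) (by simpa using hb)
    rw [one_smul, hfx] at h1 h2
    induction hv : lebesgueRep f (b • x) with
    | bot => rw [hv] at h2; simp at h2
    | top => rw [hv, ← EReal.coe_add, top_le_iff] at h1; exact absurd h1 (EReal.coe_ne_top _)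
    | coe v => exact ⟨v, rfl⟩
  choose! U hU using hreal
  have hosc : ∀ n : ℕ, 1 ≤ n → ∀ b c : ℝ, n ≤ b → n ≤ c → |U b - U c| ≤ Q n x := by
    intro n hn b c hb hc
    have hn' : (1 : ℝ) ≤ n := by exact_mod_cast hn
    have h1 := hle n hn b c hb hc
    have h2 := hle n hn c b hc hb
    rw [hU b (hn'.trans hb), hU c (hn'.trans hc), ← EReal.coe_add, EReal.coe_le_coe_iff] at h1 h2
    rw [abs_le]
    constructor <;> linarith
  have hQ0 : Tendsto (fun n : ℕ => Q n x) atTop (𝓝 0) := by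
    simpa [Function.comp_def] using (ENNReal.tendsto_toReal ENNReal.zero_ne_top).comp
      (tendsto_rayTail_zero hg.enorm hfin)
  have hcau : CauchySeq fun n : ℕ => U (n + 1 : ℕ) :=
    cauchySeq_of_le_tendsto_0' (fun n : ℕ => Q (n + 1) x)
      (fun n m hnm => (Real.dist_eq _ _).trans_le
        (hosc (n + 1) (by omega) _ _ le_rfl (by exact_mod_cast Nat.succ_le_succ hnm)))
      ((tendsto_add_atTop_iff_nat 1).2 hQ0)
  obtain ⟨c, hc'⟩ := cauchySeq_tendsto_of_complete hcau
  have hc : Tendsto (fun n : ℕ => U n) atTop (𝓝 c) := (tendsto_add_atTop_iff_nat 1).1 hc'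
  refine ⟨c, fun n hn b hb => ⟨U b, hU b (le_trans (by exact_mod_cast hn) hb), ?_⟩⟩
  have h1 : Tendsto (fun m : ℕ => |U b - U m|) atTop (𝓝 |U b - c|) :=
    (tendsto_const_nhds.sub hc).abs
  refine le_of_tendsto h1 ?_
  filter_upwards [eventually_ge_atTop n] with m hm
  exact hosc n hn b m hb (by exact_mod_cast hm)

end

/-! ### Constancy of the limit at infinity -/

section
variable {d : ℕ} {f : EuclideanSpace ℝ (Fin d) → ℝ}
  {g : EuclideanSpace ℝ (Fin d) → EuclideanSpace ℝ (Fin d)}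

theorem tendsto_setLIntegral_rayTail_zero (hd : 1 ≤ d) (hg : Measurable g)
    (hK : ∫⁻ y, ‖g y‖ₑ * radialKernel d y < ⊤) {R : ℝ} (hR : 0 < R) :
    Tendsto (fun n : ℕ => ∫⁻ x in Metric.ball 0 R, rayTail (fun y => ‖g y‖ₑ) n x) atTop (𝓝 0) := by
  have h := tendsto_lintegral_filter_of_dominated_convergence
    (μ := volume.restrict (Metric.ball (0 : EuclideanSpace ℝ (Fin d)) R)) (l := atTop)
    (F := fun n : ℕ => rayTail (fun y => ‖g y‖ₑ) n) (f := fun _ => 0)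
    (rayTail (fun y => ‖g y‖ₑ) 1)
    (Eventually.of_forall fun n => measurable_rayTail hg.enorm _)
    (by
      filter_upwards [eventually_ge_atTop 1] with n hn
      exact Eventually.of_forall fun x => rayTail_anti _ x (by exact_mod_cast hn))
    (setLIntegral_rayTail_lt_top hd hg hK one_pos hR).ne
    (by
      refine ae_restrict_of_ae ?_
      filter_upwards [ae_rayTail_lt_top hd hg hK one_pos] with x hx
      exact tendsto_rayTail_zero hg.enorm hx)
  simpa using h

/-- The gradients of the rescaled functions `x ↦ f(n x)` tend to zero in `L¹` on every ball. This
is where the dimension has to be at least two. -/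
theorem tendsto_setLIntegral_comp_smul_zero (hd : 2 ≤ d) (hg : Measurable g)
    (hK : ∫⁻ y, ‖g y‖ₑ * radialKernel d y < ⊤) (R : ℝ) :
    Tendsto (fun n : ℕ => ∫⁻ x in Metric.ball 0 R, ‖(n : ℝ) • g ((n : ℝ) • x)‖ₑ) atTop (𝓝 0) := by
  have hmeas : ∀ n : ℕ, Measurable fun y => ENNReal.ofReal ((n : ℝ) ^ (d - 1))⁻¹ *
      (Metric.ball (0 : EuclideanSpace ℝ (Fin d)) (n * R)).indicator (fun y => ‖g y‖ₑ) y :=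
    fun n => (hg.enorm.indicator Metric.isOpen_ball.measurableSet).const_mul _
  have heq : ∀ n : ℕ, 1 ≤ n → ∫⁻ x in Metric.ball 0 R, ‖(n : ℝ) • g ((n : ℝ) • x)‖ₑ
      = ∫⁻ y, ENNReal.ofReal ((n : ℝ) ^ (d - 1))⁻¹ *
        (Metric.ball (0 : EuclideanSpace ℝ (Fin d)) (n * R)).indicator (fun y => ‖g y‖ₑ) y := by
    intro n hn
    have hn0 : (0 : ℝ) < n := by exact_mod_cast hn
    have e1 : ∀ x, (Metric.ball (0 : EuclideanSpace ℝ (Fin d)) R).indicator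
        (fun x => ‖(n : ℝ) • g ((n : ℝ) • x)‖ₑ) x
        = (fun y => ENNReal.ofReal n * (Metric.ball (0 : EuclideanSpace ℝ (Fin d)) (n * R)).indicator
          (fun y => ‖g y‖ₑ) y) ((n : ℝ) • x) := by
      intro x
      simp only [Set.indicator, mem_ball_zero_iff, norm_smul, Real.norm_of_nonneg hn0.le,
        mul_lt_mul_iff_right₀ hn0]
      split_ifs
      · rw [enorm_smul, Real.enorm_of_nonneg hn0.le]
      · simp
    rw [← lintegral_indicator Metric.isOpen_ball.measurableSet, lintegral_congr e1,
      lintegral_comp_pos_smul volume (fun y => ENNReal.ofReal n *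
        (Metric.ball (0 : EuclideanSpace ℝ (Fin d)) (n * R)).indicator (fun y => ‖g y‖ₑ) y) hn0,
      ← lintegral_const_mul _ ((hg.enorm.indicator Metric.isOpen_ball.measurableSet).const_mul _)]
    refine lintegral_congr fun y => ?_
    rw [← mul_assoc, ← ENNReal.ofReal_mul (by positivity)]
    congr 2
    obtain ⟨k, rfl⟩ : ∃ k, d = k + 1 := ⟨d - 1, by omega⟩
    simp only [finrank_euclideanSpace, Fintype.card_fin, Nat.add_sub_cancel]
    field_simp
    ring
  have h := tendsto_lintegral_filter_of_dominated_convergence (μ := volume) (l := atTop)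
    (F := fun (n : ℕ) y => ENNReal.ofReal ((n : ℝ) ^ (d - 1))⁻¹ *
        (Metric.ball (0 : EuclideanSpace ℝ (Fin d)) (n * R)).indicator (fun y => ‖g y‖ₑ) y)
    (f := fun _ => 0)
    (fun y => ENNReal.ofReal ((max 1 R) ^ (d - 1)) * (‖g y‖ₑ * radialKernel d y))
    (Eventually.of_forall hmeas) ?_ ?_ ?_
  · simp only [lintegral_const, zero_mul] at h
    refine h.congr' ?_
    filter_upwards [eventually_ge_atTop 1] with n hn
    exact (heq n hn).symm
  · filter_upwards [eventually_ge_atTop 1] with n hn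
    refine Eventually.of_forall fun y => ?_
    have hn0 : (1 : ℝ) ≤ n := by exact_mod_cast hn
    by_cases hy : y ∈ Metric.ball (0 : EuclideanSpace ℝ (Fin d)) (n * R)
    · rw [Set.indicator_of_mem hy, mul_comm, mul_left_comm]
      refine mul_le_mul' le_rfl ?_
      unfold radialKernel
      rw [← ENNReal.ofReal_mul (by positivity)]
      refine ENNReal.ofReal_le_ofReal ?_
      rw [mem_ball_zero_iff] at hy
      have h1 : max 1 ‖y‖ ≤ n * max 1 R := by
        refine max_le ?_ (hy.le.trans ?_)
        · nlinarith [le_max_left 1 R]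
        · gcongr; exact le_max_right _ _
      rw [← div_eq_mul_inv, le_div_iff₀ (by positivity), inv_mul_le_iff₀ (by positivity),
        ← mul_pow]
      gcongr
    · rw [Set.indicator_of_notMem hy, mul_zero]
      exact zero_le
  · rw [lintegral_const_mul _ (show Measurable fun y => ‖g y‖ₑ * radialKernel d y from
      hg.enorm.mul (measurable_radialKernel d))]
    exact (ENNReal.mul_lt_top ENNReal.ofReal_lt_top hK).ne
  · refine Eventually.of_forall fun y => ?_
    have hlim : Tendsto (fun n : ℕ => ENNReal.ofReal ((n : ℝ) ^ (d - 1))⁻¹) atTop (𝓝 0) := by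
      have h1 : Tendsto (fun n : ℕ => ((n : ℝ) ^ (d - 1))⁻¹) atTop (𝓝 0) :=
        ((tendsto_pow_atTop (by omega)).comp tendsto_natCast_atTop_atTop).inv_tendsto_atTop
      simpa using ENNReal.tendsto_ofReal h1
    have h2 : Tendsto (fun n : ℕ => ENNReal.ofReal ((n : ℝ) ^ (d - 1))⁻¹ * ‖g y‖ₑ) atTop (𝓝 0) := by
      simpa using ENNReal.Tendsto.mul_const hlim (Or.inr (enorm_ne_top (x := g y)))
    refine tendsto_of_tendsto_of_tendsto_of_le_of_le tendsto_const_nhds h2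
      (fun _ => zero_le) fun n => ?_
    exact mul_le_mul' le_rfl (Set.indicator_le_self _ _ _)

theorem IsWeakGradient.comp_add_right (h : IsWeakGradient f g) (z : EuclideanSpace ℝ (Fin d)) :
    IsWeakGradient (fun x => f (x + z)) (fun x => g (x + z)) := by
  have hloc : ∀ {F : Type} [NormedAddCommGroup F] {k : EuclideanSpace ℝ (Fin d) → F},
      LocallyIntegrable k volume → LocallyIntegrable (fun x => k (x + z)) volume := by
    intro F _ k hk x
    obtain ⟨s, hs, hi⟩ := hk (x + z)
    refine ⟨(fun x => x + z) ⁻¹' s, (continuous_add_const z).continuousAt.preimage_mem_nhds hs, ?_⟩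
    exact ((measurePreserving_add_right volume z).integrableOn_comp_preimage
      (Homeomorph.addRight z).measurableEmbedding).2 hi
  refine ⟨hloc h.locallyIntegrable_fun, hloc h.locallyIntegrable_grad, fun φ hφ hc i => ?_⟩
  have hψ : ContDiff ℝ ∞ fun x => φ (x - z) := hφ.comp (contDiff_id.sub contDiff_const)
  have hcψ : HasCompactSupport fun x => φ (x - z) := hc.comp_homeomorph (Homeomorph.subRight z)
  have key := h.integral_eq _ hψ hcψ i
  simp only [fderiv_comp_sub] at key
  rw [← integral_add_right_eq_self _ z] at key
  rw [← integral_add_right_eq_self (fun x => g x i * φ (x - z)) z] at key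
  simpa using key

theorem IsWeakGradient.comp_pos_smul (h : IsWeakGradient f g) {b : ℝ} (hb : 0 < b) :
    IsWeakGradient (fun x => f (b • x)) (fun x => b • g (b • x)) := by
  refine ⟨LocallyIntegrable.comp_pos_smul h.locallyIntegrable_fun hb,
    (LocallyIntegrable.comp_pos_smul h.locallyIntegrable_grad hb).smul b, fun φ hφ hc i => ?_⟩
  have hψ : ContDiff ℝ ∞ fun x => φ (b⁻¹ • x) := hφ.comp (contDiff_const_smul _)
  have key := h.integral_eq _ hψ (hc.comp_pos_smul (inv_pos.2 hb)) i
  have hfd : ∀ y v, fderiv ℝ (fun y => φ (b⁻¹ • y)) y v = b⁻¹ * fderiv ℝ φ (b⁻¹ • y) v := by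
    intro y v
    have h1 := ((hφ.differentiable (by simp)) (b⁻¹ • y)).hasFDerivAt.comp y
      ((hasFDerivAt_id y).const_smul b⁻¹)
    have h2 : fderiv ℝ (fun y => φ (b⁻¹ • y)) y = _ := h1.fderiv
    rw [h2]
    simp
  have hscale : ∀ F : EuclideanSpace ℝ (Fin d) → ℝ, ∫ x, F (b • x) = (b⁻¹) ^ d * ∫ x, F x := by
    intro F
    rw [Measure.integral_comp_smul, abs_of_pos (by positivity)]
    simp
  have e1 := hscale fun y => f y * fderiv ℝ φ (b⁻¹ • y) (EuclideanSpace.single i 1)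
  have e2 := hscale fun y => g y i * φ (b⁻¹ • y)
  simp only [smul_smul, inv_mul_cancel₀ hb.ne', one_smul] at e1 e2
  rw [e1]
  simp only [PiLp.smul_apply, smul_eq_mul, mul_assoc]
  rw [integral_const_mul, e2]
  simp only [hfd, mul_left_comm _ b⁻¹, integral_const_mul] at key
  have : ∫ y, f y * fderiv ℝ φ (b⁻¹ • y) (EuclideanSpace.single i 1)
      = - (b * ∫ x, g x i * φ (b⁻¹ • x)) := by
    rw [← mul_right_inj' (inv_ne_zero hb.ne'), key]
    field_simp
  rw [this]
  ring

/-- A function with vanishing weak gradient is constant. Dilating about an arbitrary centre `z` gives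
`f((x + z) / 2) = f(x)` for almost every `x`; by symmetry `f(x) = f(z)`. -/
theorem IsWeakGradient.ae_eq_const (hd : 1 ≤ d) (hf : Measurable f)
    (h : IsWeakGradient f fun _ => 0) : ∃ c : ℝ, ∀ᵐ x, f x = c := by
  have hz : ∀ z : EuclideanSpace ℝ (Fin d), ∀ᵐ x, f ((1 / 2 : ℝ) • (x + z)) = f x := by
    intro z
    have h1 := (h.comp_add_right z).ae_sub_eq_integral_ray hd measurable_const (by simp)
      (a := 1 / 2) (b := 1) (by norm_num) (by norm_num)
    have h2 := (measurePreserving_sub_right volume z).quasiMeasurePreserving.ae h1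
    filter_upwards [h2] with x hx
    simp only [one_smul, sub_add_cancel, inner_zero_left, intervalIntegral.integral_zero] at hx
    rw [sub_eq_zero.1 hx]
    congr 1
    module
  have hmeas : MeasurableSet {q : EuclideanSpace ℝ (Fin d) × EuclideanSpace ℝ (Fin d) |
      f ((1 / 2 : ℝ) • (q.2 + q.1)) = f q.2} :=
    measurableSet_eq_fun (by fun_prop) (by fun_prop)
  have hswap := (Measure.ae_ae_comm (μ := volume) (ν := volume) hmeas).1 (Eventually.of_forall hz)
  obtain ⟨x, hx⟩ := hswap.exists
  refine ⟨f x, ?_⟩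
  filter_upwards [hx, hz x] with z h1 h2
  rw [← h1, ← h2, add_comm]


/-- If the rescaled functions `x ↦ f(n x)` converge in `L¹_loc` with the rate given by the ray
tails, then their limit has vanishing weak gradient. -/
theorem IsWeakGradient.isWeakGradient_zero_of_limit (h : IsWeakGradient f g) (hd : 2 ≤ d)
    (hg : Measurable g) (hK : ∫⁻ y, ‖g y‖ₑ * radialKernel d y < ⊤)
    {c : EuclideanSpace ℝ (Fin d) → ℝ} (hc : Measurable c)
    (hlim : ∀ n : ℕ, 1 ≤ n → ∀ᵐ x, ‖f ((n : ℝ) • x) - c x‖ₑ ≤ rayTail (fun y => ‖g y‖ₑ) n x) :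
    IsWeakGradient c fun _ => 0 := by
  have hd1 : 1 ≤ d := by omega
  have hfl : ∀ n : ℕ, 1 ≤ n → LocallyIntegrable (fun x => f ((n : ℝ) • x)) volume :=
    fun n hn => LocallyIntegrable.comp_pos_smul h.locallyIntegrable_fun (by exact_mod_cast hn)
  have hcl : LocallyIntegrable c volume := by
    refine locallyIntegrable_of_integrableOn_ball fun R hR => ?_
    have h1 : IntegrableOn f (Metric.ball 0 R) := (h.locallyIntegrable_fun.integrableOn_isCompact
      (isCompact_closedBall 0 R)).mono_set Metric.ball_subset_closedBall
    have h2 : IntegrableOn (fun x => f x - c x) (Metric.ball 0 R) := by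
      refine ⟨(h.locallyIntegrable_fun.aestronglyMeasurable.sub
        hc.aestronglyMeasurable).restrict, ?_⟩
      refine lt_of_le_of_lt (lintegral_mono_ae (ae_restrict_of_ae ?_))
        (setLIntegral_rayTail_lt_top hd1 hg hK one_pos hR)
      filter_upwards [hlim 1 le_rfl] with x hx
      simpa using hx
    exact (h1.sub h2).congr (Eventually.of_forall fun x => by simp)
  refine ⟨hcl, locallyIntegrable_const 0, fun φ hφ hφc i => ?_⟩
  simp only [PiLp.zero_apply, zero_mul, integral_zero, neg_zero]
  obtain ⟨R0, hR0⟩ := hφc.isCompact.isBounded.subset_ball 0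
  set R := max R0 1
  have hR : 0 < R := by positivity
  have hsupp : tsupport φ ⊆ Metric.ball 0 R :=
    hR0.trans (Metric.ball_subset_ball (le_max_left _ _))
  set D : EuclideanSpace ℝ (Fin d) → ℝ := fun x => fderiv ℝ φ x (EuclideanSpace.single i 1)
  have hDcont : Continuous D :=
    (hφ.continuous_fderiv (by simp)).clm_apply continuous_const
  have hDc : HasCompactSupport D := hφc.fderiv_apply ℝ _
  have hDsupp : tsupport D ⊆ Metric.ball 0 R := (tsupport_fderiv_apply_subset ℝ _).trans hsupp
  -- Pairing against a bounded function supported in the ball.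
  have hpair : ∀ ψ : EuclideanSpace ℝ (Fin d) → ℝ, Continuous ψ → HasCompactSupport ψ →
      tsupport ψ ⊆ Metric.ball 0 R → ∃ C : ℝ≥0∞, C ≠ ⊤ ∧ ∀ F : EuclideanSpace ℝ (Fin d) → ℝ,
        ‖∫ x, F x * ψ x‖ₑ ≤ C * ∫⁻ x in Metric.ball 0 R, ‖F x‖ₑ := by
    intro ψ hψ hψc hψs
    obtain ⟨C, hC⟩ := hψc.exists_bound_of_continuous hψ
    refine ⟨ENNReal.ofReal C, ENNReal.ofReal_ne_top, fun F => ?_⟩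
    refine (enorm_integral_le_lintegral_enorm _).trans ?_
    rw [← lintegral_const_mul' _ _ ENNReal.ofReal_ne_top,
      ← lintegral_indicator Metric.isOpen_ball.measurableSet]
    refine lintegral_mono fun x => ?_
    by_cases hx : x ∈ Metric.ball (0 : EuclideanSpace ℝ (Fin d)) R
    · rw [Set.indicator_of_mem hx, enorm_mul, mul_comm]
      refine mul_le_mul' ?_ le_rfl
      rw [← ofReal_norm]
      exact ENNReal.ofReal_le_ofReal (hC x)
    · rw [image_eq_zero_of_notMem_tsupport fun h' => hx (hψs h')]
      simp
  obtain ⟨C1, hC1, hpair1⟩ := hpair D hDcont hDc hDsupp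
  obtain ⟨C2, hC2, hpair2⟩ := hpair φ hφ.continuous hφc hsupp
  have hbound : ∀ n : ℕ, 1 ≤ n → ‖∫ x, c x * D x‖ₑ ≤
      C1 * (∫⁻ x in Metric.ball 0 R, rayTail (fun y => ‖g y‖ₑ) n x) +
        C2 * ∫⁻ x in Metric.ball 0 R, ‖(n : ℝ) • g ((n : ℝ) • x)‖ₑ := by
    intro n hn
    have h1 : ∫ x, c x * D x = -((∫ x, (f ((n : ℝ) • x) - c x) * D x) +
        ∫ x, ((n : ℝ) • g ((n : ℝ) • x)) i * φ x) := by
      have h2 := (h.comp_pos_smul (b := n) (by exact_mod_cast hn)).integral_eq φ hφ hφc i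
      have h3 := integral_sub
        (LocallyIntegrable.integrable_mul_of_hasCompactSupport (hfl n hn) hDcont hDc)
        (LocallyIntegrable.integrable_mul_of_hasCompactSupport hcl hDcont hDc)
      simp only [← sub_mul] at h3
      rw [h3, show (∫ x, f ((n : ℝ) • x) * D x) = _ from h2]
      ring
    rw [h1, enorm_neg]
    refine (enorm_add_le _ _).trans (add_le_add ?_ ?_)
    · refine (hpair1 _).trans (mul_le_mul' le_rfl (lintegral_mono_ae (ae_restrict_of_ae ?_)))
      exact hlim n hn
    · refine (hpair2 _).trans (mul_le_mul' le_rfl (lintegral_mono fun x => ?_))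
      rw [← ofReal_norm, ← ofReal_norm]
      exact ENNReal.ofReal_le_ofReal (PiLp.norm_apply_le _ i)
  have hto : Tendsto (fun n : ℕ =>
      C1 * (∫⁻ x in Metric.ball 0 R, rayTail (fun y => ‖g y‖ₑ) n x) +
        C2 * ∫⁻ x in Metric.ball 0 R, ‖(n : ℝ) • g ((n : ℝ) • x)‖ₑ) atTop (𝓝 0) := by
    have h1 := ENNReal.Tendsto.const_mul (tendsto_setLIntegral_rayTail_zero hd1 hg hK hR)
      (Or.inr hC1)
    have h2 := ENNReal.Tendsto.const_mul (tendsto_setLIntegral_comp_smul_zero hd hg hK R)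
      (Or.inr hC2)
    simpa using h1.add h2
  have hzero := ge_of_tendsto hto ((eventually_ge_atTop 1).mono hbound)
  exact enorm_eq_zero.1 (le_antisymm hzero zero_le)

/-- The rays along almost all directions share one limit at infinity. -/
theorem IsWeakGradient.exists_ae_ray_limit (h : IsWeakGradient f g) (hd : 2 ≤ d)
    (hg : Measurable g) (hK : ∫⁻ y, ‖g y‖ₑ * radialKernel d y < ⊤) :
    ∃ c : ℝ, ∀ᵐ x, ∀ n : ℕ, 1 ≤ n → ∀ b : ℝ, n ≤ b → ∃ v : ℝ, lebesgueRep f (b • x) = v ∧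
      |v - c| ≤ (rayTail (fun y => ‖g y‖ₑ) n x).toReal := by
  have hd1 : 1 ≤ d := by omega
  have hex := h.ae_exists_ray_limit hd1 hg hK
  have hpull : ∀ n : ℕ, ∀ᵐ x, 1 ≤ n → lebesgueRep f ((n : ℝ) • x) = f ((n : ℝ) • x) := by
    intro n
    by_cases hn : 1 ≤ n
    · have hn0 : (n : ℝ) ≠ 0 := by positivity
      have hq : Measure.QuasiMeasurePreserving
          (fun x : EuclideanSpace ℝ (Fin d) => (n : ℝ) • x) volume volume := by
        refine ⟨measurable_const_smul _, ?_⟩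
        rw [Measure.map_addHaar_smul _ hn0]
        exact Measure.smul_absolutelyContinuous
      filter_upwards [hq.ae (lebesgueRep_ae_eq h.locallyIntegrable_fun)] with x hx _
      exact hx
    · exact Eventually.of_forall fun x hn' => absurd hn' hn
  classical
  -- The limit is chosen pointwise; it is almost everywhere measurable as the limit of `f(n x)`.
  set c : EuclideanSpace ℝ (Fin d) → ℝ := fun x =>
    if hx : ∃ c : ℝ, ∀ n : ℕ, 1 ≤ n → ∀ b : ℝ, n ≤ b → ∃ v : ℝ, lebesgueRep f (b • x) = v ∧
      |v - c| ≤ (rayTail (fun y => ‖g y‖ₑ) n x).toReal then hx.choose else 0 with hc_def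
  have hc : ∀ᵐ x, ∀ n : ℕ, 1 ≤ n → ∀ b : ℝ, n ≤ b → ∃ v : ℝ, lebesgueRep f (b • x) = v ∧
      |v - c x| ≤ (rayTail (fun y => ‖g y‖ₑ) n x).toReal := by
    filter_upwards [hex] with x hx
    have : c x = hx.choose := by simp only [hc_def, dif_pos hx]
    rw [this]
    exact hx.choose_spec
  have hrate : ∀ᵐ x, ∀ n : ℕ, 1 ≤ n →
      |f ((n : ℝ) • x) - c x| ≤ (rayTail (fun y => ‖g y‖ₑ) n x).toReal := by
    filter_upwards [hc, ae_all_iff.2 hpull] with x hx hx' n hn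
    obtain ⟨v, hv, hle⟩ := hx n hn n le_rfl
    rw [hx' n hn, EReal.coe_eq_coe_iff] at hv
    rwa [hv]
  have hcm : AEMeasurable c volume := by
    refine aemeasurable_of_tendsto_metrizable_ae (u := atTop)
      (f := fun (n : ℕ) x => f ((n + 1 : ℕ) • x)) ?_ ?_
    · intro n
      have := (LocallyIntegrable.comp_pos_smul h.locallyIntegrable_fun
        (c := ((n + 1 : ℕ) : ℝ)) (by positivity)).aestronglyMeasurable.aemeasurable
      simpa only [Nat.cast_smul_eq_nsmul] using this
    · filter_upwards [hrate, ae_rayTail_lt_top hd1 hg hK one_pos] with x hx hfin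
      have h0 : Tendsto (fun n : ℕ => (rayTail (fun y => ‖g y‖ₑ) (n : ℝ) x).toReal) atTop (𝓝 0) := by
        simpa [Function.comp_def] using (ENNReal.tendsto_toReal ENNReal.zero_ne_top).comp
          (tendsto_rayTail_zero hg.enorm hfin)
      rw [tendsto_iff_dist_tendsto_zero]
      refine squeeze_zero (fun _ => dist_nonneg) (fun n => ?_) ((tendsto_add_atTop_iff_nat 1).2 h0)
      have := hx (n + 1) (by omega)
      simpa only [Real.dist_eq, Nat.cast_smul_eq_nsmul] using this
  have hcongr := hcm.ae_eq_mk
  have hweak : IsWeakGradient (hcm.mk c) fun _ => 0 := by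
    refine h.isWeakGradient_zero_of_limit hd hg hK hcm.measurable_mk fun n hn => ?_
    filter_upwards [hrate, hcongr] with x hx hx'
    rw [← hx', ← ofReal_norm, Real.norm_eq_abs]
    exact (ENNReal.ofReal_le_ofReal (hx n hn)).trans ENNReal.ofReal_toReal_le
  obtain ⟨c0, hc0⟩ := hweak.ae_eq_const hd1 hcm.measurable_mk
  refine ⟨c0, ?_⟩
  filter_upwards [hc, hcongr, hc0] with x h1 h2 h3
  rw [h2, h3] at h1
  exact h1

end

/-! ### Radial limits and limits of means -/

section
variable {d : ℕ}

/-- A property that holds almost everywhere in space holds almost everywhere on almost every ray.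
No measurability of `P` is needed. -/
theorem ae_toSphere_ae_of_ae {P : EuclideanSpace ℝ (Fin d) → Prop} (h : ∀ᵐ x, P x) :
    ∀ᵐ ξ : unitSphere d ∂(surfaceMeasure d), ∀ᵐ t : Set.Ioi (0 : ℝ)
      ∂(Measure.volumeIoiPow (Module.finrank ℝ (EuclideanSpace ℝ (Fin d)) - 1)),
      P ((t : ℝ) • (ξ : EuclideanSpace ℝ (Fin d))) := by
  have hmp := Measure.measurePreserving_homeomorphUnitSphereProd
    (volume : Measure (EuclideanSpace ℝ (Fin d)))
  have h1 : ∀ᵐ x : ({0}ᶜ : Set (EuclideanSpace ℝ (Fin d)))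
      ∂(Measure.comap (↑) (volume : Measure (EuclideanSpace ℝ (Fin d)))), P x := by
    have := (MeasurableEmbedding.subtype_coe (measurableSet_singleton
      (0 : EuclideanSpace ℝ (Fin d))).compl).ae_map_iff (p := P)
        (μ := Measure.comap (↑) (volume : Measure (EuclideanSpace ℝ (Fin d))))
    rw [← this, (MeasurableEmbedding.subtype_coe (measurableSet_singleton
      (0 : EuclideanSpace ℝ (Fin d))).compl).map_comap]
    exact ae_restrict_of_ae h
  have hsymm := hmp.symm (homeomorphUnitSphereProd (EuclideanSpace ℝ (Fin d))).toMeasurableEquiv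
  exact Measure.ae_ae_of_ae_prod (hsymm.quasiMeasurePreserving.ae h1)

/-- One half of integration in polar coordinates over the unit ball. -/
theorem lintegral_toSphere_lintegral {F : EuclideanSpace ℝ (Fin d) → ℝ≥0∞} (hF : Measurable F) :
    ∫⁻ ξ : unitSphere d, ∫⁻ t : Set.Ioi (0 : ℝ) in Set.Iio ⟨1, Set.mem_Ioi.2 one_pos⟩,
      F ((t : ℝ) • (ξ : EuclideanSpace ℝ (Fin d)))
      ∂(Measure.volumeIoiPow (Module.finrank ℝ (EuclideanSpace ℝ (Fin d)) - 1))
      ∂(surfaceMeasure d) ≤ ∫⁻ x in Metric.ball 0 1, F x := by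
  have hmp := Measure.measurePreserving_homeomorphUnitSphereProd
    (volume : Measure (EuclideanSpace ℝ (Fin d)))
  set κ := Measure.volumeIoiPow (Module.finrank ℝ (EuclideanSpace ℝ (Fin d)) - 1)
  set B := Metric.ball (0 : EuclideanSpace ℝ (Fin d)) 1
  have hB : MeasurableSet B := Metric.isOpen_ball.measurableSet
  have hH : Measurable (B.indicator F) := hF.indicator hB
  have e1 : ∀ ξ : unitSphere d, ∫⁻ t : Set.Ioi (0 : ℝ) in Set.Iio ⟨1, Set.mem_Ioi.2 one_pos⟩,
      F ((t : ℝ) • (ξ : EuclideanSpace ℝ (Fin d))) ∂κ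
      = ∫⁻ t : Set.Ioi (0 : ℝ), B.indicator F ((t : ℝ) • (ξ : EuclideanSpace ℝ (Fin d))) ∂κ := by
    intro ξ
    rw [← lintegral_indicator measurableSet_Iio]
    refine lintegral_congr fun t => ?_
    have ht : (0 : ℝ) < t := t.2
    have hn : ‖(t : ℝ) • (ξ : EuclideanSpace ℝ (Fin d))‖ = t := by
      rw [norm_smul, Real.norm_of_nonneg ht.le, norm_eq_of_mem_sphere ξ, mul_one]
    simp only [Set.indicator, B, mem_ball_zero_iff, hn, Set.mem_Iio]
    rfl
  simp_rw [e1]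
  rw [← lintegral_indicator hB]
  have hm : Measurable fun q : unitSphere d × Set.Ioi (0 : ℝ) =>
      B.indicator F ((q.2 : ℝ) • (q.1 : EuclideanSpace ℝ (Fin d))) :=
    hH.comp (by fun_prop)
  have h2 := lintegral_prod (μ := surfaceMeasure d) (ν := κ) _ hm.aemeasurable
  simp only at h2
  rw [← h2]
  have hsymm := hmp.symm (homeomorphUnitSphereProd (EuclideanSpace ℝ (Fin d))).toMeasurableEquiv
  have h3 := hsymm.lintegral_comp (f := fun x : ({0}ᶜ : Set (EuclideanSpace ℝ (Fin d))) =>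
    B.indicator F x) (hH.comp measurable_subtype_coe)
  refine (le_of_eq h3).trans ?_
  rw [← (MeasurableEmbedding.subtype_coe (measurableSet_singleton
      (0 : EuclideanSpace ℝ (Fin d))).compl).lintegral_map,
      (MeasurableEmbedding.subtype_coe (measurableSet_singleton
      (0 : EuclideanSpace ℝ (Fin d))).compl).map_comap]
  exact setLIntegral_le_lintegral _ _


variable {u : EuclideanSpace ℝ (Fin d) → EReal} {c : ℝ}
  {Q : ℕ → EuclideanSpace ℝ (Fin d) → ℝ≥0∞}

theorem abs_sub_le_of_ray
    (hu : ∀ᵐ x, ∀ n : ℕ, 1 ≤ n → ∀ b : ℝ, n ≤ b →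
      ∃ v : ℝ, u (b • x) = v ∧ |v - c| ≤ (Q n x).toReal) :
    ∀ᵐ x, ∀ n : ℕ, 1 ≤ n → ∀ b : ℝ, n ≤ b → (u (b • x) - c).abs ≤ Q n x := by
  filter_upwards [hu] with x hx n hn b hb
  obtain ⟨v, hv, hle⟩ := hx n hn b hb
  rw [hv, ← EReal.coe_sub, EReal.abs_def]
  exact (ENNReal.ofReal_le_ofReal hle).trans ENNReal.ofReal_toReal_le

theorem volumeIoiPow_Iio_one_pos (n : ℕ) :
    0 < Measure.volumeIoiPow n (Set.Iio ⟨1, Set.mem_Ioi.2 one_pos⟩) := by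
  rw [Measure.volumeIoiPow_apply_Iio, ENNReal.ofReal_pos]
  simp only [one_pow]
  positivity

theorem hasRadialLimit_of_ray
    (hu : ∀ᵐ x, ∀ n : ℕ, 1 ≤ n → ∀ b : ℝ, n ≤ b →
      ∃ v : ℝ, u (b • x) = v ∧ |v - c| ≤ (Q n x).toReal)
    (hQ : ∀ᵐ x, Tendsto (fun n => Q n x) atTop (𝓝 0)) : HasRadialLimit u c := by
  have h1 : ∀ᵐ x, Tendsto (fun b : ℝ => u (b • x)) atTop (𝓝 (c : EReal)) := by
    filter_upwards [hu, hQ] with x hx hQx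
    have hQr : Tendsto (fun b : ℝ => (Q ⌊b⌋₊ x).toReal) atTop (𝓝 0) := by
      simpa [Function.comp_def] using
        ((ENNReal.tendsto_toReal ENNReal.zero_ne_top).comp hQx).comp (tendsto_nat_floor_atTop (α := ℝ))
    choose! v hv hle using hx
    have hvb : ∀ b : ℝ, 1 ≤ b → u (b • x) = v ⌊b⌋₊ b ∧ |v ⌊b⌋₊ b - c| ≤ (Q ⌊b⌋₊ x).toReal := by
      intro b hb
      have h2 : 1 ≤ ⌊b⌋₊ := Nat.le_floor (by simpa using hb)
      have h3 : (⌊b⌋₊ : ℝ) ≤ b := Nat.floor_le (by linarith)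
      exact ⟨hv _ h2 b h3, hle _ h2 b h3⟩
    have hlim : Tendsto (fun b : ℝ => v ⌊b⌋₊ b) atTop (𝓝 c) := by
      rw [tendsto_iff_dist_tendsto_zero]
      refine squeeze_zero' (Eventually.of_forall fun _ => dist_nonneg) ?_ hQr
      filter_upwards [eventually_ge_atTop 1] with b hb
      exact (hvb b hb).2
    refine ((continuous_coe_real_ereal.tendsto c).comp hlim).congr' ?_
    filter_upwards [eventually_ge_atTop 1] with b hb
    exact (hvb b hb).1.symm
  filter_upwards [ae_toSphere_ae_of_ae h1] with ξ hξ
  have hne : (ae (Measure.volumeIoiPow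
      (Module.finrank ℝ (EuclideanSpace ℝ (Fin d)) - 1))).NeBot := by
    rw [ae_neBot]
    intro h0
    have := volumeIoiPow_Iio_one_pos (Module.finrank ℝ (EuclideanSpace ℝ (Fin d)) - 1)
    rw [h0] at this
    simp at this
  obtain ⟨t, ht⟩ := hξ.exists
  have ht0 : (0 : ℝ) < t := t.2
  refine (ht.comp (tendsto_id.atTop_div_const ht0)).congr fun s => ?_
  simp only [Function.comp_apply, id, smul_smul]
  rw [div_mul_cancel₀ _ ht0.ne']

theorem surfaceMeasure_ne_zero (hd : 1 ≤ d) : surfaceMeasure d ≠ 0 := by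
  have : Nonempty (Fin d) := ⟨⟨0, hd⟩⟩
  exact Measure.toSphere_ne_zero _

instance : IsFiniteMeasure (surfaceMeasure d) :=
  inferInstanceAs (IsFiniteMeasure (volume : Measure (EuclideanSpace ℝ (Fin d))).toSphere)

theorem tendsto_comp_floor {a : ℕ → ℝ≥0∞} (ha : Tendsto a atTop (𝓝 0)) {C : ℝ≥0∞} (hC : C ≠ ⊤) :
    Tendsto (fun r : ℝ => C * a ⌊r⌋₊) atTop (𝓝 0) := by
  simpa [Function.comp_def] using
    ENNReal.Tendsto.const_mul (ha.comp (tendsto_nat_floor_atTop (α := ℝ))) (Or.inr hC)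

theorem hasSphericalMeanLimit_of_ray (hd : 1 ≤ d)
    (hu : ∀ᵐ x, ∀ n : ℕ, 1 ≤ n → ∀ b : ℝ, n ≤ b →
      ∃ v : ℝ, u (b • x) = v ∧ |v - c| ≤ (Q n x).toReal)
    (hQm : ∀ n, Measurable (Q n))
    (hQ : Tendsto (fun n => ∫⁻ x in Metric.ball 0 1, Q n x) atTop (𝓝 0)) :
    HasSphericalMeanLimit u c := by
  set κ := Measure.volumeIoiPow (Module.finrank ℝ (EuclideanSpace ℝ (Fin d)) - 1)
  set I : Set (Set.Ioi (0 : ℝ)) := Set.Iio ⟨1, Set.mem_Ioi.2 one_pos⟩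
  have hκ0 : κ I ≠ 0 := (volumeIoiPow_Iio_one_pos _).ne'
  have hκt : κ I ≠ ⊤ := by
    simp only [κ, I, Measure.volumeIoiPow_apply_Iio]
    exact ENNReal.ofReal_ne_top
  -- Averaging over the base point `t • ξ` of the ray, `0 < t < 1`, turns the bound on almost
  -- every ray into a bound by an integral over the unit ball.
  have hmain : ∀ r : ℝ, 1 ≤ r → ∫⁻ ξ : unitSphere d,
      (u (r • (ξ : EuclideanSpace ℝ (Fin d))) - (c : EReal)).abs ∂(surfaceMeasure d)
        ≤ (κ I)⁻¹ * ∫⁻ x in Metric.ball 0 1, Q ⌊r⌋₊ x := by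
    intro r hr
    have hn1 : 1 ≤ ⌊r⌋₊ := Nat.le_floor (by simpa using hr)
    have hnr : (⌊r⌋₊ : ℝ) ≤ r := Nat.floor_le (by linarith)
    rw [mul_comm, ← div_eq_mul_inv, ENNReal.le_div_iff_mul_le (Or.inl hκ0) (Or.inl hκt),
      ← lintegral_mul_const' _ _ hκt]
    refine le_trans (lintegral_mono_ae ?_) (lintegral_toSphere_lintegral (hQm ⌊r⌋₊))
    filter_upwards [ae_toSphere_ae_of_ae (abs_sub_le_of_ray hu)] with ξ hξ
    rw [← setLIntegral_const]
    refine setLIntegral_mono_ae' measurableSet_Iio ?_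
    filter_upwards [hξ] with t ht htI
    have ht0 : (0 : ℝ) < t := t.2
    have ht1 : (t : ℝ) < 1 := htI
    have := ht ⌊r⌋₊ hn1 (r / t) (hnr.trans ((le_div_iff₀ ht0).2 (by nlinarith)))
    rwa [smul_smul, div_mul_cancel₀ _ ht0.ne'] at this
  unfold HasSphericalMeanLimit
  have hσ : surfaceMeasure d Set.univ ≠ 0 :=
    Measure.measure_univ_ne_zero.2 (surfaceMeasure_ne_zero hd)
  refine tendsto_of_tendsto_of_tendsto_of_le_of_le' tendsto_const_nhds
    (tendsto_comp_floor hQ (C := (surfaceMeasure d Set.univ)⁻¹ * (κ I)⁻¹)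
      (ENNReal.mul_ne_top (ENNReal.inv_ne_top.2 hσ) (ENNReal.inv_ne_top.2 hκ0)))
    (Eventually.of_forall fun _ => zero_le) ?_
  filter_upwards [eventually_ge_atTop 1] with r hr
  rw [laverage_eq, ENNReal.div_eq_inv_mul, mul_assoc]
  exact mul_le_mul' le_rfl (hmain r hr)

open scoped Pointwise in
theorem setLAverage_smul_le (F : EuclideanSpace ℝ (Fin d) → ℝ≥0∞)
    {S : Set (EuclideanSpace ℝ (Fin d))} (hS : MeasurableSet S) (hS1 : S ⊆ Metric.ball 0 1) {t : ℝ}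
    (ht : 0 < t) :
    (⨍⁻ x in t • S, F x ∂volume) ≤ (volume S)⁻¹ * ∫⁻ y in Metric.ball 0 1, F (t • y) := by
  have hmem : ∀ y, t • y ∈ t • S ↔ y ∈ S := fun y => Set.smul_mem_smul_set_iff₀ ht.ne' S y
  have h1 := lintegral_comp_pos_smul (volume : Measure (EuclideanSpace ℝ (Fin d)))
    ((t • S).indicator F) ht
  have h2 : ∀ y, (t • S).indicator F (t • y) = S.indicator (fun y => F (t • y)) y := by
    intro y
    by_cases hy : y ∈ S
    · rw [Set.indicator_of_mem hy, Set.indicator_of_mem ((hmem y).2 hy)]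
    · rw [Set.indicator_of_notMem hy, Set.indicator_of_notMem fun h => hy ((hmem y).1 h)]
  rw [lintegral_congr h2, lintegral_indicator hS, lintegral_indicator (hS.const_smul₀ t)] at h1
  set T := ENNReal.ofReal (t ^ Module.finrank ℝ (EuclideanSpace ℝ (Fin d)))⁻¹ with hT
  have hv : (volume (t • S))⁻¹ = (volume S)⁻¹ * T := by
    rw [Measure.addHaar_smul, abs_of_pos (by positivity), mul_comm,
      ENNReal.mul_inv (Or.inr ENNReal.ofReal_ne_top)
        (Or.inr (ENNReal.ofReal_pos.2 (by positivity)).ne'), hT,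
      ENNReal.ofReal_inv_of_pos (by positivity)]
  rw [setLAverage_eq, ENNReal.div_eq_inv_mul, hv, mul_assoc, ← h1]
  exact mul_le_mul' le_rfl (lintegral_mono_set hS1)

theorem setLIntegral_ball_comp_smul_le
    (hu : ∀ᵐ x, ∀ n : ℕ, 1 ≤ n → ∀ b : ℝ, n ≤ b →
      ∃ v : ℝ, u (b • x) = v ∧ |v - c| ≤ (Q n x).toReal) {t : ℝ} (ht : 1 ≤ t) :
    ∫⁻ y in Metric.ball 0 1, (u (t • y) - c).abs ≤ ∫⁻ x in Metric.ball 0 1, Q ⌊t⌋₊ x := by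
  refine lintegral_mono_ae (ae_restrict_of_ae ?_)
  filter_upwards [abs_sub_le_of_ray hu] with x hx
  exact hx ⌊t⌋₊ (Nat.le_floor (by simpa using ht)) t (Nat.floor_le (by linarith))

theorem volume_annulus_pos [Nonempty (Fin d)] {a b : ℝ} (ha : 0 ≤ a) (hab : a < b) :
    0 < volume (Metric.ball (0 : EuclideanSpace ℝ (Fin d)) b \ Metric.ball 0 a) := by
  refine lt_of_lt_of_le ?_ le_measure_sdiff
  rw [tsub_pos_iff_lt, Measure.addHaar_ball _ _ ha, Measure.addHaar_ball _ _ (ha.trans hab.le)]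
  refine ENNReal.mul_lt_mul_left (Metric.measure_ball_pos volume _ one_pos).ne'
    measure_ball_lt_top.ne ?_
  rw [ENNReal.ofReal_lt_ofReal_iff (by have := ha.trans_lt hab; positivity)]
  exact pow_lt_pow_left₀ hab ha Module.finrank_pos.ne'

open scoped Pointwise in
theorem hasAnnularMeanLimit_of_ray (hd : 1 ≤ d)
    (hu : ∀ᵐ x, ∀ n : ℕ, 1 ≤ n → ∀ b : ℝ, n ≤ b →
      ∃ v : ℝ, u (b • x) = v ∧ |v - c| ≤ (Q n x).toReal)
    (hQ : Tendsto (fun n => ∫⁻ x in Metric.ball 0 1, Q n x) atTop (𝓝 0)) :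
    HasAnnularMeanLimit u c := by
  have : Nonempty (Fin d) := ⟨⟨0, hd⟩⟩
  set S : Set (EuclideanSpace ℝ (Fin d)) := Metric.ball 0 1 \ Metric.ball 0 (1 / 2) with hS_def
  have hS : MeasurableSet S := Metric.isOpen_ball.measurableSet.diff Metric.isOpen_ball.measurableSet
  have hS0 : volume S ≠ 0 := (volume_annulus_pos (by norm_num) (by norm_num)).ne'
  refine tendsto_of_tendsto_of_tendsto_of_le_of_le' tendsto_const_nhds
    (tendsto_comp_floor hQ (C := (volume S)⁻¹) (ENNReal.inv_ne_top.2 hS0))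
    (Eventually.of_forall fun _ => zero_le) ?_
  filter_upwards [eventually_ge_atTop 1] with t ht
  have ht0 : 0 < t := by linarith
  have hset : Metric.ball (0 : EuclideanSpace ℝ (Fin d)) t \ Metric.ball 0 (t / 2) = t • S := by
    rw [hS_def, Set.smul_set_sdiff₀ ht0.ne', smul_ball ht0.ne', smul_ball ht0.ne', smul_zero,
      Real.norm_of_nonneg ht0.le]
    ring_nf
  rw [hset]
  exact (setLAverage_smul_le (fun x => (u x - c).abs) hS Set.sdiff_subset ht0).trans
    (mul_le_mul' le_rfl (setLIntegral_ball_comp_smul_le hu ht))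

open scoped Pointwise in
theorem hasBallMeanLimit_of_ray
    (hu : ∀ᵐ x, ∀ n : ℕ, 1 ≤ n → ∀ b : ℝ, n ≤ b →
      ∃ v : ℝ, u (b • x) = v ∧ |v - c| ≤ (Q n x).toReal)
    (hQ : Tendsto (fun n => ∫⁻ x in Metric.ball 0 1, Q n x) atTop (𝓝 0)) :
    HasBallMeanLimit u c := by
  set V := volume (Metric.ball (0 : EuclideanSpace ℝ (Fin d)) (1 / 4))
  have hV0 : V ≠ 0 := (Metric.measure_ball_pos volume _ (by norm_num)).ne'
  have hlim := (tendsto_comp_floor hQ (C := V⁻¹) (ENNReal.inv_ne_top.2 hV0)).comp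
    ((tendsto_norm_cobounded_atTop (E := EuclideanSpace ℝ (Fin d))).const_mul_atTop two_pos)
  refine tendsto_of_tendsto_of_tendsto_of_le_of_le' tendsto_const_nhds hlim
    (Eventually.of_forall fun _ => zero_le) ?_
  filter_upwards [tendsto_norm_cobounded_atTop.eventually_ge_atTop 1] with x hx
  have ht : 1 ≤ 2 * ‖x‖ := by linarith
  have ht0 : 0 < 2 * ‖x‖ := by linarith
  -- The ball `B(x, |x|/2)` is the dilation by `2|x|` of a ball of radius `1/4` inside `B(0, 1)`.
  have hset : Metric.ball x (‖x‖ / 2) = (2 * ‖x‖) • Metric.ball ((2 * ‖x‖)⁻¹ • x) (1 / 4) := by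
    rw [smul_ball ht0.ne', smul_smul, mul_inv_cancel₀ ht0.ne', one_smul,
      Real.norm_of_nonneg ht0.le]
    ring_nf
  have hsub : Metric.ball ((2 * ‖x‖)⁻¹ • x) (1 / 4) ⊆ Metric.ball 0 1 := by
    refine Metric.ball_subset_ball' ?_
    have : ‖x‖ ≠ 0 := by linarith
    rw [dist_zero_right, norm_smul, norm_inv, Real.norm_of_nonneg ht0.le]
    field_simp
    norm_num
  have hvol : volume (Metric.ball ((2 * ‖x‖)⁻¹ • x) (1 / 4)) = V :=
    Measure.addHaar_ball_center _ _ _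
  rw [hset]
  refine (setLAverage_smul_le (fun x => (u x - c).abs) Metric.isOpen_ball.measurableSet hsub
    ht0).trans ?_
  rw [hvol]
  exact mul_le_mul' le_rfl (setLIntegral_ball_comp_smul_le hu ht)

theorem IsWeakGradient.exists_limits {f : EuclideanSpace ℝ (Fin d) → ℝ}
    {g : EuclideanSpace ℝ (Fin d) → EuclideanSpace ℝ (Fin d)} (h : IsWeakGradient f g) (hd : 2 ≤ d)
    (hg : Measurable g) (hK : ∫⁻ y, ‖g y‖ₑ * radialKernel d y < ⊤) :
    ∃ c : ℝ, HasRadialLimit (lebesgueRep f) c ∧ HasSphericalMeanLimit (lebesgueRep f) c ∧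
      HasAnnularMeanLimit (lebesgueRep f) c ∧ HasBallMeanLimit (lebesgueRep f) c := by
  have hd1 : 1 ≤ d := by omega
  obtain ⟨c, hc⟩ := h.exists_ae_ray_limit hd hg hK
  have hQ := tendsto_setLIntegral_rayTail_zero hd1 hg hK one_pos
  refine ⟨c, hasRadialLimit_of_ray hc ?_,
    hasSphericalMeanLimit_of_ray hd1 hc (fun n => measurable_rayTail hg.enorm _) hQ,
    hasAnnularMeanLimit_of_ray hd1 hc hQ, hasBallMeanLimit_of_ray hc hQ⟩
  filter_upwards [ae_rayTail_lt_top hd1 hg hK one_pos] with x hx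
  exact tendsto_rayTail_zero hg.enorm hx

end

/-! ### Muckenhoupt weights -/

section
variable {d : ℕ} {p : ℝ} {w : EuclideanSpace ℝ (Fin d) → ℝ}

/-- Duality form of the assertion that `|y|^{1-d}` lies in the dual of `L^p(ℝ^d, w)` away from the
origin. All conditions on radial limits and on limits of means are equivalent to it. -/
def RadiallySummable (d : ℕ) (p : ℝ) (w : EuclideanSpace ℝ (Fin d) → ℝ) : Prop :=
  ∀ G : EuclideanSpace ℝ (Fin d) → ℝ≥0∞, Measurable G →
    ∫⁻ y, G y ^ p ∂(weightedMeasure w) < ⊤ →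
      ∫⁻ y in (Metric.ball 0 1)ᶜ, G y * radialKernel d y < ⊤

theorem weightedMeasure_absolutelyContinuous : weightedMeasure w ≪ volume :=
  withDensity_absolutelyContinuous _ _

instance : SFinite (weightedMeasure w) :=
  inferInstanceAs (SFinite (volume.withDensity _))

theorem IsMuckenhouptWeight.aemeasurable (hw : IsMuckenhouptWeight p w) :
    AEMeasurable (fun x => ENNReal.ofReal (w x)) volume :=
  hw.locallyIntegrable.aestronglyMeasurable.aemeasurable.ennreal_ofReal

theorem IsMuckenhouptWeight.measure_lt_top (hw : IsMuckenhouptWeight p w)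
    {K : Set (EuclideanSpace ℝ (Fin d))} (hK : IsCompact K) : weightedMeasure w K < ⊤ := by
  rw [weightedMeasure, withDensity_apply _ hK.measurableSet]
  refine lt_of_le_of_lt (lintegral_mono fun x => ?_) (hw.locallyIntegrable.integrableOn_isCompact hK).2
  exact Real.ofReal_le_enorm _

theorem IsMuckenhouptWeight.weightedMeasure_ball_lt_top (hw : IsMuckenhouptWeight p w)
    (x : EuclideanSpace ℝ (Fin d)) (r : ℝ) : weightedMeasure w (Metric.ball x r) < ⊤ :=
  (measure_mono Metric.ball_subset_closedBall).trans_lt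
    (hw.measure_lt_top (isCompact_closedBall x r))

theorem IsMuckenhouptWeight.volume_absolutelyContinuous (hw : IsMuckenhouptWeight p w) :
    volume ≪ weightedMeasure w := by
  refine withDensity_absolutelyContinuous' hw.aemeasurable ?_
  filter_upwards [hw.pos] with x hx
  exact (ENNReal.ofReal_pos.2 hx).ne'

theorem IsMuckenhouptWeight.weightedMeasure_ball_ne_zero (hw : IsMuckenhouptWeight p w)
    (x : EuclideanSpace ℝ (Fin d)) {r : ℝ} (hr : 0 < r) : weightedMeasure w (Metric.ball x r) ≠ 0 :=
  fun h => (Metric.measure_ball_pos volume x hr).ne' (hw.volume_absolutelyContinuous h)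

/-- The `A_p` condition as a weighted Jensen inequality for averages over balls. -/
theorem IsMuckenhouptWeight.average_rpow_mul_le (hp : 1 ≤ p) (hw : IsMuckenhouptWeight p w) :
    ∃ C : ℝ≥0∞, C ≠ ⊤ ∧ ∀ (x : EuclideanSpace ℝ (Fin d)) (r : ℝ), 0 < r →
      ∀ G : EuclideanSpace ℝ (Fin d) → ℝ≥0∞, Measurable G →
        ((∫⁻ y in Metric.ball x r, G y) / volume (Metric.ball x r)) ^ p *
          weightedMeasure w (Metric.ball x r) ≤
            C * ∫⁻ y in Metric.ball x r, G y ^ p ∂(weightedMeasure w) := by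
  obtain ⟨C, hC⟩ := hw.condition
  refine ⟨C, ENNReal.coe_ne_top, fun x r hr G hG => ?_⟩
  set B := Metric.ball x r
  have hB : MeasurableSet B := Metric.isOpen_ball.measurableSet
  set W : EuclideanSpace ℝ (Fin d) → ℝ≥0∞ := fun y => ENNReal.ofReal (w y) with hW
  have hWm : AEMeasurable W (volume.restrict B) := hw.aemeasurable.restrict
  have hV0 : volume B ≠ 0 := (Metric.measure_ball_pos volume x hr).ne'
  have hVt : volume B ≠ ⊤ := MeasureTheory.measure_ball_lt_top.ne
  set V := volume B
  have hWB : weightedMeasure w B = ∫⁻ y in B, W y := withDensity_apply _ hB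
  have hGB : ∫⁻ y in B, G y ^ p ∂(weightedMeasure w) = ∫⁻ y in B, W y * G y ^ p := by
    rw [weightedMeasure, restrict_withDensity hB,
      lintegral_withDensity_eq_lintegral_mul₀ hWm (hG.pow_const p).aemeasurable]
    rfl
  rw [hWB, hGB]
  unfold MuckenhouptCondition at hC
  rcases eq_or_lt_of_le hp with rfl | hp1
  · rw [if_pos rfl] at hC
    have h1 := hC x r hr
    rw [setLAverage_eq] at h1
    simp only [ENNReal.rpow_one]
    calc (∫⁻ y in B, G y) / V * ∫⁻ y in B, W y
        = (∫⁻ y in B, G y) * ((∫⁻ y in B, W y) / V) := by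
          rw [ENNReal.div_eq_inv_mul, ENNReal.div_eq_inv_mul]; ring
      _ = ∫⁻ y in B, G y * ((∫⁻ y in B, W y) / V) := (lintegral_mul_const _ hG).symm
      _ ≤ ∫⁻ y in B, C * (W y * G y) := by
          refine lintegral_mono_ae ?_
          filter_upwards [h1] with y hy
          rw [← mul_assoc, mul_comm]
          exact mul_le_mul' hy le_rfl
      _ = C * ∫⁻ y in B, W y * G y := lintegral_const_mul' _ _ ENNReal.coe_ne_top
  · rw [if_neg hp1.ne'] at hC
    have h1 := hC x r hr
    rw [setLAverage_eq, setLAverage_eq] at h1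
    have hp0 : 0 < p := by linarith
    have hpp : 0 < p - 1 := by linarith
    have hpq : p.HolderConjugate (p / (p - 1)) := Real.HolderConjugate.conjExponent hp1
    set X := ∫⁻ y in B, W y * G y ^ p
    set Y := ∫⁻ y in B, W y ^ (-(1 / (p - 1)))
    -- Hölder's inequality for `G w^{1/p}` and `w^{-1/p}`; here `0 < w < ∞` almost everywhere.
    have hholder : (∫⁻ y in B, G y) ≤ X ^ (1 / p) * Y ^ (1 / (p / (p - 1))) := by
      have h2 := ENNReal.lintegral_mul_le_Lp_mul_Lq (volume.restrict B) hpq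
        (f := fun y => G y * W y ^ (1 / p)) (g := fun y => W y ^ (-(1 / p)))
        (hG.aemeasurable.mul (hWm.pow_const _)) (hWm.pow_const _)
      refine le_trans (le_trans (le_of_eq ?_) h2) (le_of_eq ?_)
      · refine lintegral_congr_ae (ae_restrict_of_ae ?_)
        filter_upwards [hw.pos] with y hy
        have hy0 : W y ≠ 0 := (ENNReal.ofReal_pos.2 hy).ne'
        simp only [Pi.mul_apply]
        rw [mul_assoc, ← ENNReal.rpow_add _ _ hy0 ENNReal.ofReal_ne_top, add_neg_cancel,
          ENNReal.rpow_zero, mul_one]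
      · congr 2
        · refine lintegral_congr fun y => ?_
          rw [ENNReal.mul_rpow_of_nonneg _ _ hp0.le, ← ENNReal.rpow_mul, one_div,
            inv_mul_cancel₀ hp0.ne', ENNReal.rpow_one, mul_comm]
        · refine lintegral_congr fun y => ?_
          rw [← ENNReal.rpow_mul]
          congr 1
          field_simp
    have hpow : (∫⁻ y in B, G y) ^ p ≤ X * Y ^ (p - 1) := by
      refine (ENNReal.rpow_le_rpow hholder hp0.le).trans (le_of_eq ?_)
      rw [ENNReal.mul_rpow_of_nonneg _ _ hp0.le, ← ENNReal.rpow_mul, ← ENNReal.rpow_mul]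
      congr 1
      · rw [one_div, inv_mul_cancel₀ hp0.ne', ENNReal.rpow_one]
      · congr 1
        field_simp
    have hVp : (V ^ p)⁻¹ = V⁻¹ * (V ^ (p - 1))⁻¹ := by
      rw [← ENNReal.mul_inv (Or.inl hV0) (Or.inl hVt)]
      congr 1
      conv_rhs => rw [← ENNReal.rpow_one V]
      rw [← ENNReal.rpow_mul, one_mul, ← ENNReal.rpow_add _ _ hV0 hVt]
      congr 1
      ring
    calc ((∫⁻ y in B, G y) / V) ^ p * ∫⁻ y in B, W y
        = (∫⁻ y in B, G y) ^ p * (V ^ p)⁻¹ * ∫⁻ y in B, W y := by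
          rw [ENNReal.div_rpow_of_nonneg _ _ hp0.le, div_eq_mul_inv]
      _ ≤ X * Y ^ (p - 1) * (V ^ p)⁻¹ * ∫⁻ y in B, W y := by gcongr
      _ = ((∫⁻ y in B, W y) / V * (Y / V) ^ (p - 1)) * X := by
          rw [ENNReal.div_rpow_of_nonneg _ _ hpp.le, div_eq_mul_inv, div_eq_mul_inv, hVp]
          ring
      _ ≤ C * X := mul_le_mul' h1 le_rfl

/-- Functions in `L^p(w)` are locally integrable with respect to Lebesgue measure. -/
theorem IsMuckenhouptWeight.setLIntegral_ball_lt_top (hp : 1 ≤ p) (hw : IsMuckenhouptWeight p w)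
    {G : EuclideanSpace ℝ (Fin d) → ℝ≥0∞} (hG : Measurable G)
    (hGp : ∫⁻ y, G y ^ p ∂(weightedMeasure w) < ⊤) {R : ℝ} (hR : 0 < R) :
    ∫⁻ y in Metric.ball 0 R, G y < ⊤ := by
  obtain ⟨C, hC, h⟩ := hw.average_rpow_mul_le hp
  have h1 := (h 0 R hR G hG).trans_lt (ENNReal.mul_lt_top hC.lt_top
    ((setLIntegral_le_lintegral _ _).trans_lt hGp))
  by_contra hcon
  rw [not_lt, top_le_iff] at hcon
  rw [hcon, ENNReal.top_div_of_ne_top MeasureTheory.measure_ball_lt_top.ne,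
    ENNReal.top_rpow_of_pos (by linarith), ENNReal.top_mul (hw.weightedMeasure_ball_ne_zero 0 hR)] at h1
  exact lt_irrefl _ h1

/-- Under `RadiallySummable`, every element of the homogeneous Sobolev space has all the limits, with
a common value. -/
theorem RadiallySummable.exists_limits (hd : 2 ≤ d) (hp : 1 ≤ p) (hK : RadiallySummable d p w)
    {u : EuclideanSpace ℝ (Fin d) → EReal} (hu : u ∈ homogeneousSobolev d p w) :
    ∃ c : ℝ, HasRadialLimit u c ∧ HasSphericalMeanLimit u c ∧ HasAnnularMeanLimit u c ∧
      HasBallMeanLimit u c := by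
  obtain ⟨f, g, -, hfg, hg, rfl⟩ := hu
  have hgs := hfg.locallyIntegrable_grad.aestronglyMeasurable
  set g' := hgs.mk g
  have hgm : Measurable g' := hgs.stronglyMeasurable_mk.measurable
  have hgg : g =ᵐ[volume] g' := hgs.ae_eq_mk
  have hfg' : IsWeakGradient f g' := by
    refine ⟨hfg.locallyIntegrable_fun, hfg.locallyIntegrable_grad.congr hgg, fun φ hφ hc i => ?_⟩
    rw [hfg.integral_eq φ hφ hc i]
    congr 1
    refine integral_congr_ae ?_
    filter_upwards [hgg] with x hx
    rw [hx]
  refine hfg'.exists_limits hd hgm ?_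
  have hp0 : 0 < p := by linarith
  have hgp : ∫⁻ y, ‖g' y‖ₑ ^ p ∂(weightedMeasure w) < ⊤ := by
    have h1 := (eLpNorm_lt_top_iff_lintegral_rpow_enorm_lt_top (by simpa using hp0)
      ENNReal.ofReal_ne_top).1 hg.2
    rw [ENNReal.toReal_ofReal hp0.le] at h1
    refine lt_of_le_of_lt (le_of_eq (lintegral_congr_ae ?_)) h1
    filter_upwards [weightedMeasure_absolutelyContinuous.ae_le hgg] with x hx
    rw [hx]
  rw [← lintegral_add_compl _ (Metric.isOpen_ball (x := (0 : EuclideanSpace ℝ (Fin d)))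
    (ε := 1)).measurableSet]
  refine ENNReal.add_lt_top.2 ⟨?_, hK _ hgm.enorm hgp⟩
  refine lt_of_le_of_lt (lintegral_mono fun y => ?_)
    ((hfg'.locallyIntegrable_grad.integrableOn_isCompact (isCompact_closedBall 0 1)).mono_set
      Metric.ball_subset_closedBall).2
  refine mul_le_of_le_one_right zero_le ?_
  unfold radialKernel
  rw [← ENNReal.ofReal_one]
  exact ENNReal.ofReal_le_ofReal (inv_le_one_of_one_le₀ (one_le_pow₀ (le_max_left _ _)))

end

/-! ### Radial functions -/

section
variable {d : ℕ}

theorem lebesgueRep_eq_of_continuous {f : EuclideanSpace ℝ (Fin d) → ℝ} (hf : Continuous f)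
    (x : EuclideanSpace ℝ (Fin d)) : lebesgueRep f x = f x := by
  refine lebesgueRep_eq_of_tendsto (Metric.tendsto_nhds.2 fun ε hε => ?_)
  obtain ⟨δ, hδ, h⟩ := Metric.continuous_iff.1 hf x (ε / 2) (by positivity)
  filter_upwards [Ioo_mem_nhdsGT hδ] with r hr
  have hmem : (⨍ y in Metric.ball x r, f y) ∈ Metric.closedBall (f x) (ε / 2) := by
    refine (convex_closedBall _ _).set_average_mem Metric.isClosed_closedBall
      (Metric.measure_ball_pos volume x hr.1).ne' measure_ball_lt_top.ne ?_ ?_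
    · filter_upwards [ae_restrict_mem Metric.isOpen_ball.measurableSet] with y hy
      exact (h y (lt_trans hy hr.2)).le
    · exact (hf.locallyIntegrable.integrableOn_isCompact (isCompact_closedBall x r)).mono_set
        Metric.ball_subset_closedBall
  rw [Metric.mem_closedBall] at hmem
  linarith

/-- The radial vector field `ρ(|x|) x / |x|`, for profiles `ρ` that vanish on `[0, 1/2]`; the
truncation of the denominator keeps it continuous at the origin. -/
noncomputable def radialField (ρ : ℝ → ℝ) (x : EuclideanSpace ℝ (Fin d)) :
    EuclideanSpace ℝ (Fin d) :=
  (ρ ‖x‖ / max ‖x‖ (1 / 2)) • x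

variable {ρ : ℝ → ℝ}

theorem continuous_radialField (hρ : Continuous ρ) :
    Continuous (radialField (d := d) ρ) := by
  unfold radialField
  refine Continuous.smul (Continuous.div (hρ.comp continuous_norm)
    (continuous_norm.max continuous_const) fun x => ?_) continuous_id
  positivity

theorem norm_radialField (hρ0 : ∀ r, 0 ≤ ρ r) (hρ1 : ∀ r ≤ 1 / 2, ρ r = 0)
    (x : EuclideanSpace ℝ (Fin d)) : ‖radialField ρ x‖ = ρ ‖x‖ := by
  unfold radialField
  rcases le_or_gt ‖x‖ (1 / 2) with h | h
  · simp [hρ1 _ h]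
  · have : 0 < ‖x‖ := by linarith
    rw [max_eq_left h.le, norm_smul, Real.norm_of_nonneg (div_nonneg (hρ0 _) this.le)]
    field_simp

theorem hasFDerivAt_radial (hρ : Continuous ρ) (hρ1 : ∀ r ≤ 1 / 2, ρ r = 0)
    (x : EuclideanSpace ℝ (Fin d)) :
    HasFDerivAt (fun x : EuclideanSpace ℝ (Fin d) => ∫ s in (0 : ℝ)..‖x‖, ρ s)
      (innerSL ℝ (radialField ρ x)) x := by
  rcases lt_or_ge ‖x‖ (1 / 2) with h | h
  · have h0 : radialField ρ x = 0 := by simp [radialField, hρ1 _ h.le]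
    rw [h0, map_zero]
    refine (hasFDerivAt_const (0 : ℝ) x).congr_of_eventuallyEq ?_
    filter_upwards [continuous_norm.continuousAt.eventually_lt continuousAt_const h] with y hy
    refine intervalIntegral.integral_zero_ae (Eventually.of_forall fun s hs => hρ1 s ?_)
    rw [Set.uIoc_of_le (norm_nonneg y)] at hs
    exact hs.2.trans (le_of_lt hy)
  · have hx : 0 < ‖x‖ := by linarith
    have h1 : HasFDerivAt (fun x : EuclideanSpace ℝ (Fin d) => √(‖x‖ ^ 2))
        ((1 / (2 * √(‖x‖ ^ 2))) • (2 • innerSL ℝ x)) x :=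
      (hasStrictFDerivAt_norm_sq x).hasFDerivAt.sqrt (by positivity)
    have h2 : HasDerivAt (fun r : ℝ => ∫ s in (0 : ℝ)..r, ρ s) (ρ ‖x‖) (√(‖x‖ ^ 2)) := by
      rw [Real.sqrt_sq hx.le]
      exact hρ.integral_hasStrictDerivAt 0 ‖x‖ |>.hasDerivAt
    have h3 := h2.comp_hasFDerivAt x h1
    have h4 : (fun r : ℝ => ∫ s in (0 : ℝ)..r, ρ s) ∘
        (fun x : EuclideanSpace ℝ (Fin d) => √(‖x‖ ^ 2)) = fun x => ∫ s in (0 : ℝ)..‖x‖, ρ s := by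
      ext y
      simp
    rw [h4] at h3
    refine h3.congr_fderiv ?_
    ext v
    simp only [Real.sqrt_sq hx.le, radialField, max_eq_left h, map_smul,
      smul_apply, innerSL_apply_apply, smul_eq_mul, nsmul_eq_mul]
    push_cast
    field_simp

theorem continuous_radial (hρ : Continuous ρ) :
    Continuous fun x : EuclideanSpace ℝ (Fin d) => ∫ s in (0 : ℝ)..‖x‖, ρ s :=
  (intervalIntegral.continuous_primitive (fun _ _ => hρ.intervalIntegrable _ _) 0).comp
    continuous_norm

theorem isWeakGradient_radial (hρ : Continuous ρ) (hρ1 : ∀ r ≤ 1 / 2, ρ r = 0) :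
    IsWeakGradient (fun x : EuclideanSpace ℝ (Fin d) => ∫ s in (0 : ℝ)..‖x‖, ρ s)
      (radialField ρ) := by
  have hf := continuous_radial (d := d) hρ
  have hg := continuous_radialField (d := d) hρ
  refine ⟨hf.locallyIntegrable, hg.locallyIntegrable, fun φ hφ hc i => ?_⟩
  have hfd : ∀ x : EuclideanSpace ℝ (Fin d),
      fderiv ℝ (fun x : EuclideanSpace ℝ (Fin d) => ∫ s in (0 : ℝ)..‖x‖, ρ s) x
        (EuclideanSpace.single i 1) = radialField ρ x i := by
    intro x
    rw [(hasFDerivAt_radial hρ hρ1 x).fderiv]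
    simp [innerSL_apply_apply, EuclideanSpace.inner_single_right]
  have hDc : Continuous fun x => fderiv ℝ φ x (EuclideanSpace.single i 1) :=
    (hφ.continuous_fderiv (by simp)).clm_apply continuous_const
  have h := integral_mul_fderiv_eq_neg_fderiv_mul_of_integrable (μ := volume)
    (f := fun x : EuclideanSpace ℝ (Fin d) => ∫ s in (0 : ℝ)..‖x‖, ρ s) (g := φ)
    (v := EuclideanSpace.single i 1) ?_ ?_ ?_ ?_ ?_
  · simpa only [hfd] using h
  · simp only [hfd]
    exact LocallyIntegrable.integrable_mul_of_hasCompactSupport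
      (LocallyIntegrable.coord hg.locallyIntegrable i) hφ.continuous hc
  · exact LocallyIntegrable.integrable_mul_of_hasCompactSupport hf.locallyIntegrable hDc
      (hc.fderiv_apply ℝ _)
  · exact LocallyIntegrable.integrable_mul_of_hasCompactSupport hf.locallyIntegrable
      hφ.continuous hc
  · exact fun x _ => (hasFDerivAt_radial hρ hρ1 x).differentiableAt
  · exact fun x _ => (hφ.differentiable (by simp)) x

theorem radial_mem_homogeneousSobolev {p : ℝ} {w : EuclideanSpace ℝ (Fin d) → ℝ} (hp : 1 ≤ p)
    (hw : IsMuckenhouptWeight p w) (hρ : Continuous ρ) (hρ0 : ∀ r, 0 ≤ ρ r)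
    (hρ1 : ∀ r ≤ 1 / 2, ρ r = 0)
    (hρp : ∫⁻ x, ENNReal.ofReal (ρ ‖x‖) ^ p ∂(weightedMeasure w) < ⊤) :
    (fun x : EuclideanSpace ℝ (Fin d) => ((∫ s in (0 : ℝ)..‖x‖, ρ s : ℝ) : EReal)) ∈
      homogeneousSobolev d p w := by
  have hf := continuous_radial (d := d) hρ
  have hp0 : 0 < p := by linarith
  refine ⟨fun x => ∫ s in (0 : ℝ)..‖x‖, ρ s, radialField ρ, fun K hK => ?_,
    isWeakGradient_radial hρ hρ1, ⟨?_, ?_⟩, ?_⟩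
  · have : IsFiniteMeasure ((weightedMeasure w).restrict K) :=
      ⟨by rw [Measure.restrict_apply_univ]; exact hw.measure_lt_top hK⟩
    obtain ⟨C, hC⟩ := hK.exists_bound_of_continuousOn hf.continuousOn
    exact MemLp.of_bound hf.aestronglyMeasurable C
      ((ae_restrict_mem hK.measurableSet).mono hC)
  · exact (continuous_radialField hρ).aestronglyMeasurable
  · rw [eLpNorm_lt_top_iff_lintegral_rpow_enorm_lt_top (by simpa using hp0)
      ENNReal.ofReal_ne_top, ENNReal.toReal_ofReal hp0.le]
    simpa only [← ofReal_norm, norm_radialField hρ0 hρ1] using hρp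
  · ext x
    exact (lebesgueRep_eq_of_continuous hf x).symm

end

/-! ### Functions tending to infinity -/

section
variable {d : ℕ} {v : ℝ → ℝ}

theorem not_boundedLiminfOnSomeRay_of_tendsto (hv : Tendsto v atTop atTop) :
    ¬ BoundedLiminfOnSomeRay fun x : EuclideanSpace ℝ (Fin d) => (v ‖x‖ : EReal) := by
  rintro ⟨ξ, hξ⟩
  have h : Tendsto (fun t : ℝ => ((v ‖t • (ξ : EuclideanSpace ℝ (Fin d))‖ : ℝ) : EReal).abs) atTop
      (𝓝 ⊤) := by
    simp only [EReal.abs_def]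
    refine ENNReal.tendsto_ofReal_atTop.comp (tendsto_abs_atTop_atTop.comp (hv.comp ?_))
    refine tendsto_id.congr' ?_
    filter_upwards [eventually_ge_atTop 0] with t ht
    rw [norm_smul, norm_eq_of_mem_sphere ξ, mul_one, Real.norm_of_nonneg ht, id]
  exact hξ.ne h.liminf_eq

theorem one_le_setLAverage {α : Type*} [MeasurableSpace α] {μ : Measure α} {S : Set α}
    (hS : MeasurableSet S) (h0 : μ S ≠ 0) (ht : μ S ≠ ⊤) {F : α → ℝ≥0∞} (hF : ∀ x ∈ S, 1 ≤ F x) :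
    1 ≤ ⨍⁻ x in S, F x ∂μ := by
  rw [setLAverage_eq, ENNReal.le_div_iff_mul_le (Or.inl h0) (Or.inl ht), one_mul]
  exact setLIntegral_one (μ := μ) S ▸ setLIntegral_mono' hS hF

theorem exists_one_le_abs_sub (hv : Tendsto v atTop atTop) (c : ℝ) :
    ∃ R : ℝ, ∀ r : ℝ, R ≤ r → 1 ≤ ((v r : EReal) - (c : EReal)).abs := by
  obtain ⟨R, hR⟩ := eventually_atTop.1 (hv.eventually_ge_atTop (c + 1))
  refine ⟨R, fun r hr => ?_⟩
  have := hR r hr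
  rw [← EReal.coe_sub, EReal.abs_def, ← ENNReal.ofReal_one]
  exact ENNReal.ofReal_le_ofReal (le_abs.2 (Or.inl (by linarith)))

theorem not_tendsto_zero_of_eventually_one_le {α : Type*} {l : Filter α} [l.NeBot] {F : α → ℝ≥0∞}
    (h : ∀ᶠ x in l, 1 ≤ F x) : ¬ Tendsto F l (𝓝 0) := fun hF =>
  absurd (ge_of_tendsto hF h) (by simp)

theorem not_hasSphericalMeanLimit_of_tendsto (hd : 1 ≤ d) (hv : Tendsto v atTop atTop) (c : ℝ) :
    ¬ HasSphericalMeanLimit (fun x : EuclideanSpace ℝ (Fin d) => (v ‖x‖ : EReal)) c := by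
  obtain ⟨R, hR⟩ := exists_one_le_abs_sub hv c
  refine not_tendsto_zero_of_eventually_one_le ?_
  filter_upwards [eventually_ge_atTop (max 0 R)] with r hr
  rw [← Measure.restrict_univ (μ := surfaceMeasure d)]
  refine one_le_setLAverage MeasurableSet.univ
    (Measure.measure_univ_ne_zero.2 (surfaceMeasure_ne_zero hd)) (measure_ne_top _ _) fun ξ _ => ?_
  refine hR _ ?_
  rw [norm_smul, norm_eq_of_mem_sphere ξ, mul_one]
  exact (le_max_right 0 R).trans (hr.trans (Real.le_norm_self r))

theorem not_hasAnnularMeanLimit_of_tendsto (hd : 1 ≤ d) (hv : Tendsto v atTop atTop) (c : ℝ) :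
    ¬ HasAnnularMeanLimit (fun x : EuclideanSpace ℝ (Fin d) => (v ‖x‖ : EReal)) c := by
  have : Nonempty (Fin d) := ⟨⟨0, hd⟩⟩
  obtain ⟨R, hR⟩ := exists_one_le_abs_sub hv c
  refine not_tendsto_zero_of_eventually_one_le ?_
  filter_upwards [eventually_ge_atTop (2 * R), eventually_gt_atTop 0] with t ht ht0
  refine one_le_setLAverage (Metric.isOpen_ball.measurableSet.diff Metric.isOpen_ball.measurableSet)
    (volume_annulus_pos (by linarith) (by linarith)).ne'
    ((measure_mono Set.sdiff_subset).trans_lt measure_ball_lt_top).ne fun x hx => hR _ ?_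
  have := hx.2
  rw [mem_ball_zero_iff, not_lt] at this
  linarith

theorem not_hasBallMeanLimit_of_tendsto (hd : 1 ≤ d) (hv : Tendsto v atTop atTop) (c : ℝ) :
    ¬ HasBallMeanLimit (fun x : EuclideanSpace ℝ (Fin d) => (v ‖x‖ : EReal)) c := by
  have : Nonempty (Fin d) := ⟨⟨0, hd⟩⟩
  obtain ⟨R, hR⟩ := exists_one_le_abs_sub hv c
  refine not_tendsto_zero_of_eventually_one_le ?_
  filter_upwards [tendsto_norm_cobounded_atTop.eventually_ge_atTop (2 * R),
    tendsto_norm_cobounded_atTop.eventually_gt_atTop 0] with x hx hx0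
  refine one_le_setLAverage Metric.isOpen_ball.measurableSet
    (Metric.measure_ball_pos volume x (by linarith)).ne' measure_ball_lt_top.ne fun y hy => hR _ ?_
  rw [Metric.mem_ball, dist_comm, dist_eq_norm] at hy
  have := norm_sub_norm_le x y
  linarith

end

/-! ### Failure of radial summability -/

section
variable {d : ℕ}

/-- The open annulus `r < |y| < 2r`. -/
def annulus (d : ℕ) (r : ℝ) : Set (EuclideanSpace ℝ (Fin d)) := {y | r < ‖y‖ ∧ ‖y‖ < 2 * r}

theorem measurableSet_annulus (r : ℝ) : MeasurableSet (annulus d r) :=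
  (measurableSet_lt measurable_const measurable_norm).inter
    (measurableSet_lt measurable_norm measurable_const)

theorem annulus_subset_ball (r : ℝ) : annulus d r ⊆ Metric.ball 0 (2 * r) :=
  fun y hy => by simpa using hy.2

/-- The normalised integrals of `γ` over annuli, truncated near `r = 0`. -/
noncomputable def annulusMean (γ : EuclideanSpace ℝ (Fin d) → ℝ) (r : ℝ) : ℝ :=
  ((max r (1 / 2)) ^ d)⁻¹ * ∫ y in annulus d r, γ y

variable {γ : EuclideanSpace ℝ (Fin d) → ℝ}

theorem annulusMean_nonneg (h0 : ∀ y, 0 ≤ γ y) (r : ℝ) : 0 ≤ annulusMean γ r :=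
  mul_nonneg (by positivity) (integral_nonneg h0)

theorem annulusMean_eq_zero (h1 : ∀ y, ‖y‖ < 1 → γ y = 0) {r : ℝ} (hr : r ≤ 1 / 2) :
    annulusMean γ r = 0 := by
  unfold annulusMean
  rw [setIntegral_eq_zero_of_forall_eq_zero, mul_zero]
  intro y hy
  exact h1 y (by linarith [hy.2])

theorem continuous_annulusMean (hd : 1 ≤ d) (hγ : LocallyIntegrable γ volume) :
    Continuous (annulusMean γ) := by
  have : Nonempty (Fin d) := ⟨⟨0, hd⟩⟩
  refine Continuous.mul ?_ ?_
  · refine Continuous.inv₀ (by fun_prop) fun r => ?_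
    positivity
  rw [continuous_iff_continuousAt]
  intro r
  have heq : (fun r => ∫ y in annulus d r, γ y) = fun r => ∫ y, (annulus d r).indicator γ y := by
    ext r
    rw [integral_indicator (measurableSet_annulus r)]
  rw [heq]
  set R := 2 * (r + 1)
  refine continuousAt_of_dominated (bound := (Metric.closedBall 0 R).indicator fun y => ‖γ y‖)
    (Eventually.of_forall fun s => hγ.aestronglyMeasurable.indicator (measurableSet_annulus s))
    ?_ ?_ ?_
  · filter_upwards [Iio_mem_nhds (lt_add_one r)] with s (hs : s < r + 1)
    refine Eventually.of_forall fun y => ?_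
    rw [norm_indicator_eq_indicator_norm]
    refine Set.indicator_le_indicator_of_subset ?_ (fun _ => norm_nonneg _) y
    refine (annulus_subset_ball s).trans (Metric.ball_subset_closedBall.trans
      (Metric.closedBall_subset_closedBall ?_))
    linarith
  · rw [integrable_indicator_iff Metric.isClosed_closedBall.measurableSet]
    exact (hγ.integrableOn_isCompact (isCompact_closedBall 0 R)).norm
  · have hsph : ∀ s : ℝ, ∀ᵐ y : EuclideanSpace ℝ (Fin d), ‖y‖ ≠ s := by
      intro s
      have h0 := Measure.addHaar_sphere (volume : Measure (EuclideanSpace ℝ (Fin d))) 0 s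
      filter_upwards [measure_eq_zero_iff_ae_notMem.1 h0] with y hy hys
      exact hy (by simpa using hys)
    filter_upwards [hsph r, hsph (2 * r)] with y hy1 hy2
    have hev : ∀ᶠ s in 𝓝 r, (y ∈ annulus d s ↔ y ∈ annulus d r) := by
      have e1 : ∀ᶠ s in 𝓝 r, (s < ‖y‖ ↔ r < ‖y‖) := by
        rcases lt_or_gt_of_ne hy1 with h | h
        · filter_upwards [Ioi_mem_nhds h] with s (hs : ‖y‖ < s)
          exact iff_of_false hs.not_gt h.not_gt
        · filter_upwards [Iio_mem_nhds h] with s (hs : s < ‖y‖)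
          exact iff_of_true hs h
      have e2 : ∀ᶠ s in 𝓝 r, (‖y‖ < 2 * s ↔ ‖y‖ < 2 * r) := by
        rcases lt_or_gt_of_ne hy2 with h | h
        · filter_upwards [Ioi_mem_nhds (show ‖y‖ / 2 < r by linarith)] with s (hs : ‖y‖ / 2 < s)
          exact iff_of_true (by linarith) h
        · filter_upwards [Iio_mem_nhds (show r < ‖y‖ / 2 by linarith)] with s (hs : s < ‖y‖ / 2)
          exact iff_of_false (by linarith) h.not_gt
      filter_upwards [e1, e2] with s h1 h2
      simp only [annulus, Set.mem_ofPred_eq, h1, h2]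
    refine continuousAt_const.congr (f := fun _ => (annulus d r).indicator γ y) ?_
    filter_upwards [hev] with s hs
    by_cases hy : y ∈ annulus d r
    · rw [Set.indicator_of_mem hy, Set.indicator_of_mem (hs.2 hy)]
    · rw [Set.indicator_of_notMem hy, Set.indicator_of_notMem fun h => hy (hs.1 h)]

theorem ofReal_annulusMean (hγ : LocallyIntegrable γ volume) (h0 : ∀ y, 0 ≤ γ y) {r : ℝ}
    (hr : 1 / 2 ≤ r) :
    ENNReal.ofReal (annulusMean γ r) =
      ENNReal.ofReal (r ^ d)⁻¹ * ∫⁻ y in annulus d r, ENNReal.ofReal (γ y) := by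
  have hr0 : 0 < r := by linarith
  rw [annulusMean, max_eq_left hr, ENNReal.ofReal_mul (by positivity),
    ofReal_integral_eq_lintegral_ofReal]
  · exact (hγ.integrableOn_isCompact (isCompact_closedBall 0 (2 * r))).mono_set
      ((annulus_subset_ball r).trans Metric.ball_subset_closedBall)
  · exact Eventually.of_forall h0

theorem measurableSet_annulus_prod :
    MeasurableSet {q : EuclideanSpace ℝ (Fin d) × ℝ | q.1 ∈ annulus d q.2} :=
  (measurableSet_lt measurable_snd measurable_fst.norm).inter
    (measurableSet_lt measurable_fst.norm (measurable_snd.const_mul 2))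

/-- The integral of the annulus means diverges if the integral of `γ` against `radialKernel` does:
a point `y` belongs to the annuli with `|y|/2 < s < |y|`. -/
theorem lintegral_annulusMean_eq_top (hγ : LocallyIntegrable γ volume) (hγm : Measurable γ)
    (h0 : ∀ y, 0 ≤ γ y) (h1 : ∀ y, ‖y‖ < 1 → γ y = 0) (hd : 1 ≤ d)
    (htop : ∫⁻ y, ENNReal.ofReal (γ y) * radialKernel d y = ⊤) :
    ∫⁻ s in Set.Ioi 0, ENNReal.ofReal (annulusMean γ s) = ⊤ := by
  rw [← top_le_iff]
  have hmeas : Measurable fun q : EuclideanSpace ℝ (Fin d) × ℝ => ENNReal.ofReal (q.2 ^ d)⁻¹ *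
      {q : EuclideanSpace ℝ (Fin d) × ℝ | q.1 ∈ annulus d q.2}.indicator
        (fun q => ENNReal.ofReal (γ q.1)) q :=
    (by fun_prop : Measurable fun q : EuclideanSpace ℝ (Fin d) × ℝ =>
      ENNReal.ofReal (q.2 ^ d)⁻¹).mul
      ((hγm.comp measurable_fst).ennreal_ofReal.indicator measurableSet_annulus_prod)
  have hpt : ∀ y, ENNReal.ofReal (1 / 2) * (ENNReal.ofReal (γ y) * radialKernel d y) ≤
      ∫⁻ s in Set.Ioi (1 / 2), ENNReal.ofReal (s ^ d)⁻¹ *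
        (annulus d s).indicator (fun y => ENNReal.ofReal (γ y)) y := by
    intro y
    rcases lt_or_ge ‖y‖ 1 with hy | hy
    · simp [h1 y hy]
    have hy0 : 0 < ‖y‖ := by linarith
    have hvol : volume (Set.Ioo (‖y‖ / 2) ‖y‖) = ENNReal.ofReal (‖y‖ / 2) := by
      rw [Real.volume_Ioo]
      congr 1
      ring
    calc ENNReal.ofReal (1 / 2) * (ENNReal.ofReal (γ y) * radialKernel d y)
        = ENNReal.ofReal (‖y‖ ^ d)⁻¹ * ENNReal.ofReal (γ y) *
            volume (Set.Ioo (‖y‖ / 2) ‖y‖) := by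
          have key : ENNReal.ofReal (1 / 2) * ENNReal.ofReal (‖y‖ ^ (d - 1))⁻¹ =
              ENNReal.ofReal (‖y‖ ^ d)⁻¹ * ENNReal.ofReal (‖y‖ / 2) := by
            rw [← ENNReal.ofReal_mul (by positivity), ← ENNReal.ofReal_mul (by positivity)]
            congr 1
            obtain ⟨k, rfl⟩ : ∃ k, d = k + 1 := ⟨d - 1, by omega⟩
            rw [Nat.add_sub_cancel]
            field_simp
            ring
          rw [hvol, radialKernel, max_eq_right hy, mul_left_comm, key]
          ring
      _ = ∫⁻ s in Set.Ioo (‖y‖ / 2) ‖y‖, ENNReal.ofReal (‖y‖ ^ d)⁻¹ * ENNReal.ofReal (γ y) :=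
          (setLIntegral_const _ _).symm
      _ ≤ ∫⁻ s in Set.Ioo (‖y‖ / 2) ‖y‖, ENNReal.ofReal (s ^ d)⁻¹ *
            (annulus d s).indicator (fun y => ENNReal.ofReal (γ y)) y := by
          refine setLIntegral_mono' measurableSet_Ioo fun s hs => ?_
          have hs0 : 0 < s := by linarith [hs.1]
          have hmem : y ∈ annulus d s := ⟨hs.2, by linarith [hs.1]⟩
          rw [Set.indicator_of_mem hmem]
          refine mul_le_mul' (ENNReal.ofReal_le_ofReal ?_) le_rfl
          gcongr
          exact hs.2.le
      _ ≤ _ := by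
          refine lintegral_mono_set fun s hs => ?_
          exact Set.mem_Ioi.2 (by linarith [hs.1])
  calc (⊤ : ℝ≥0∞)
      = ENNReal.ofReal (1 / 2) * ∫⁻ y, ENNReal.ofReal (γ y) * radialKernel d y := by
        rw [htop, ENNReal.mul_top (by simp)]
    _ = ∫⁻ y, ENNReal.ofReal (1 / 2) * (ENNReal.ofReal (γ y) * radialKernel d y) :=
        (lintegral_const_mul' _ _ ENNReal.ofReal_ne_top).symm
    _ ≤ ∫⁻ y, ∫⁻ s in Set.Ioi (1 / 2), ENNReal.ofReal (s ^ d)⁻¹ *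
        (annulus d s).indicator (fun y => ENNReal.ofReal (γ y)) y := lintegral_mono hpt
    _ = ∫⁻ s in Set.Ioi (1 / 2), ∫⁻ y, ENNReal.ofReal (s ^ d)⁻¹ *
        (annulus d s).indicator (fun y => ENNReal.ofReal (γ y)) y :=
        lintegral_lintegral_swap hmeas.aemeasurable
    _ = ∫⁻ s in Set.Ioi (1 / 2), ENNReal.ofReal (annulusMean γ s) := by
        refine setLIntegral_congr_fun measurableSet_Ioi fun s hs => ?_
        rw [ofReal_annulusMean hγ h0 (le_of_lt hs), lintegral_const_mul' _ _ ENNReal.ofReal_ne_top,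
          lintegral_indicator (measurableSet_annulus s)]
    _ ≤ _ := lintegral_mono_set (Set.Ioi_subset_Ioi (by norm_num))

theorem tendsto_primitive_atTop {ρ : ℝ → ℝ} (hρ : Continuous ρ) (hρ0 : ∀ r, 0 ≤ ρ r)
    (htop : ∫⁻ s in Set.Ioi 0, ENNReal.ofReal (ρ s) = ⊤) :
    Tendsto (fun r => ∫ s in (0 : ℝ)..r, ρ s) atTop atTop := by
  have hmono : Monotone fun r => ∫ s in (0 : ℝ)..r, ρ s := by
    intro a b hab
    have := intervalIntegral.integral_add_adjacent_intervals
      (hρ.intervalIntegrable (μ := volume) 0 a) (hρ.intervalIntegrable a b)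
    have h2 := intervalIntegral.integral_nonneg (μ := volume) hab fun s _ => hρ0 s
    simp only
    linarith
  refine tendsto_atTop_atTop_of_monotone hmono ?_
  by_contra! hcon
  obtain ⟨b, hb⟩ := hcon
  have hint := integrableOn_Ioi_of_intervalIntegral_norm_bounded (μ := volume) (l := atTop)
    (b := fun i : ℝ => i) (f := ρ) b 0 (fun i => hρ.integrableOn_Ioc) tendsto_id
    (Eventually.of_forall fun i => by
      simpa only [Real.norm_of_nonneg (hρ0 _)] using (hb i).le)
  have := hint.2
  simp only [HasFiniteIntegral, Real.enorm_of_nonneg (hρ0 _), htop] at this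
  exact lt_irrefl _ this

/-- The annulus means inherit the weighted `L^p` bound. After the `A_p` condition on the ball
`B(0, 2|x|)`, Tonelli's theorem leaves the integral of `μ(B(0, 2|x|))⁻¹` over `|y|/2 < |x| < |y|`,
which is at most one. -/
theorem IsMuckenhouptWeight.lintegral_annulusMean_rpow_lt_top {p : ℝ}
    {w : EuclideanSpace ℝ (Fin d) → ℝ} (hp : 1 ≤ p) (hw : IsMuckenhouptWeight p w)
    (hγ : LocallyIntegrable γ volume) (hγm : Measurable γ)
    (h0 : ∀ y, 0 ≤ γ y) (h1 : ∀ y, ‖y‖ < 1 → γ y = 0)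
    (hγp : ∫⁻ y, ENNReal.ofReal (γ y) ^ p ∂(weightedMeasure w) < ⊤) :
    ∫⁻ x, ENNReal.ofReal (annulusMean γ ‖x‖) ^ p ∂(weightedMeasure w) < ⊤ := by
  obtain ⟨C, hC, hAp⟩ := hw.average_rpow_mul_le hp
  have hp0 : 0 < p := by linarith
  set μ := weightedMeasure w
  set G : EuclideanSpace ℝ (Fin d) → ℝ≥0∞ := fun y => ENNReal.ofReal (γ y)
  have hG : Measurable G := hγm.ennreal_ofReal
  set m : ℝ → ℝ≥0∞ := fun r => μ (Metric.ball 0 (2 * r))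
  have hm : Measurable m := by
    have : Monotone m := fun a b hab => measure_mono (Metric.ball_subset_ball (by linarith))
    exact this.measurable
  set A : ℝ≥0∞ := ENNReal.ofReal (2 ^ d) * volume (Metric.ball (0 : EuclideanSpace ℝ (Fin d)) 1)
    with hA
  have hA0 : A ≠ 0 := mul_ne_zero (ENNReal.ofReal_pos.2 (by positivity)).ne'
    (Metric.measure_ball_pos volume _ one_pos).ne'
  have hAt : A ≠ ⊤ := ENNReal.mul_ne_top ENNReal.ofReal_ne_top measure_ball_lt_top.ne
  -- The `A_p` condition on `B(0, 2|x|)`, applied to `γ` restricted to the annulus.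
  have hpt : ∀ x : EuclideanSpace ℝ (Fin d), ENNReal.ofReal (annulusMean γ ‖x‖) ^ p ≤
      A ^ p * C * ∫⁻ y, (m ‖x‖)⁻¹ * (annulus d ‖x‖).indicator (fun y => G y ^ p) y ∂μ := by
    intro x
    rcases le_or_gt ‖x‖ (1 / 2) with hx | hx
    · rw [annulusMean_eq_zero h1 hx, ENNReal.ofReal_zero, ENNReal.zero_rpow_of_pos hp0]
      exact zero_le
    have hx0 : 0 < ‖x‖ := by linarith
    have hm0 : m ‖x‖ ≠ 0 := hw.weightedMeasure_ball_ne_zero 0 (by linarith)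
    have hmt : m ‖x‖ ≠ ⊤ := (hw.weightedMeasure_ball_lt_top 0 _).ne
    have h2 := hAp 0 (2 * ‖x‖) (by linarith) ((annulus d ‖x‖).indicator G)
      (hG.indicator (measurableSet_annulus _))
    have h3 : ∫⁻ y in Metric.ball 0 (2 * ‖x‖), (annulus d ‖x‖).indicator G y
        = ∫⁻ y in annulus d ‖x‖, G y := by
      rw [setLIntegral_indicator (measurableSet_annulus _),
        Set.inter_eq_left.2 (annulus_subset_ball _)]
    have h4 : ∫⁻ y in Metric.ball 0 (2 * ‖x‖), (annulus d ‖x‖).indicator G y ^ p ∂μ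
        ≤ ∫⁻ y, (annulus d ‖x‖).indicator (fun y => G y ^ p) y ∂μ := by
      refine (setLIntegral_le_lintegral _ _).trans (lintegral_mono fun y => ?_)
      by_cases hy : y ∈ annulus d ‖x‖
      · simp only [Set.indicator_of_mem hy, le_refl]
      · simp only [Set.indicator_of_notMem hy, ENNReal.zero_rpow_of_pos hp0, le_refl]
    have h5 : ENNReal.ofReal (annulusMean γ ‖x‖) =
        A * ((∫⁻ y in annulus d ‖x‖, G y) / volume (Metric.ball (0 : EuclideanSpace ℝ (Fin d))
          (2 * ‖x‖))) := by
      have hV : volume (Metric.ball (0 : EuclideanSpace ℝ (Fin d)) (2 * ‖x‖)) =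
          A * ENNReal.ofReal (‖x‖ ^ d) := by
        rw [Measure.addHaar_ball_of_pos _ _ (by linarith), finrank_euclideanSpace,
          Fintype.card_fin, mul_pow, ENNReal.ofReal_mul (by positivity), hA]
        ring
      rw [ofReal_annulusMean hγ h0 hx.le, hV, ENNReal.div_eq_inv_mul,
        ENNReal.mul_inv (Or.inl hA0) (Or.inl hAt), ENNReal.ofReal_inv_of_pos (by positivity),
        ← mul_assoc, ← mul_assoc, ENNReal.mul_inv_cancel hA0 hAt, one_mul]
    rw [h3] at h2
    rw [lintegral_const_mul' _ _ (ENNReal.inv_ne_top.2 hm0), h5,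
      ENNReal.mul_rpow_of_nonneg _ _ hp0.le, mul_assoc]
    refine mul_le_mul' le_rfl ?_
    rw [mul_left_comm, ← ENNReal.div_eq_inv_mul, ENNReal.le_div_iff_mul_le (Or.inl hm0) (Or.inl hmt)]
    exact h2.trans (mul_le_mul' le_rfl h4)
  -- If `y` lies in the annulus of `x`, then `x ∈ B(0, |y|) ⊆ B(0, 2|x|)`.
  have hinner : ∀ y, ∫⁻ x, (m ‖x‖)⁻¹ * (annulus d ‖x‖).indicator (fun y => G y ^ p) y ∂μ
      ≤ G y ^ p := by
    intro y
    rcases lt_or_ge ‖y‖ 1 with hy | hy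
    · have : G y = 0 := by simp [G, h1 y hy]
      have h6 : ∀ x : EuclideanSpace ℝ (Fin d),
          (annulus d ‖x‖).indicator (fun y => G y ^ p) y = 0 := fun x => by
        simp [Set.indicator, this, ENNReal.zero_rpow_of_pos hp0]
      simp [h6]
    calc ∫⁻ x, (m ‖x‖)⁻¹ * (annulus d ‖x‖).indicator (fun y => G y ^ p) y ∂μ
        ≤ ∫⁻ x, (Metric.ball 0 ‖y‖).indicator
            (fun _ => (μ (Metric.ball 0 ‖y‖))⁻¹ * G y ^ p) x ∂μ := by
          refine lintegral_mono fun x => ?_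
          by_cases hx : y ∈ annulus d ‖x‖
          · have hx' : x ∈ Metric.ball (0 : EuclideanSpace ℝ (Fin d)) ‖y‖ := by
              simpa using hx.1
            rw [Set.indicator_of_mem hx, Set.indicator_of_mem hx']
            refine mul_le_mul' (ENNReal.inv_le_inv.2 (measure_mono ?_)) le_rfl
            exact Metric.ball_subset_ball hx.2.le
          · rw [Set.indicator_of_notMem hx, mul_zero]
            exact zero_le
      _ = (μ (Metric.ball 0 ‖y‖))⁻¹ * G y ^ p * μ (Metric.ball 0 ‖y‖) := by
          rw [lintegral_indicator Metric.isOpen_ball.measurableSet, setLIntegral_const]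
      _ = G y ^ p := by
          rw [mul_right_comm, ENNReal.inv_mul_cancel
            (hw.weightedMeasure_ball_ne_zero 0 (by linarith))
            (hw.weightedMeasure_ball_lt_top 0 _).ne, one_mul]
  have hmeas : Measurable fun q : EuclideanSpace ℝ (Fin d) × EuclideanSpace ℝ (Fin d) =>
      (m ‖q.1‖)⁻¹ * {q : EuclideanSpace ℝ (Fin d) × EuclideanSpace ℝ (Fin d) |
        q.2 ∈ annulus d ‖q.1‖}.indicator (fun q => G q.2 ^ p) q := by
    refine ((hm.comp measurable_fst.norm).inv).mul ?_
    refine ((hG.comp measurable_snd).pow_const p).indicator ?_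
    exact (measurableSet_lt measurable_fst.norm measurable_snd.norm).inter
      (measurableSet_lt measurable_snd.norm (measurable_fst.norm.const_mul 2))
  calc ∫⁻ x, ENNReal.ofReal (annulusMean γ ‖x‖) ^ p ∂μ
      ≤ ∫⁻ x, A ^ p * C * ∫⁻ y, (m ‖x‖)⁻¹ *
          (annulus d ‖x‖).indicator (fun y => G y ^ p) y ∂μ ∂μ := lintegral_mono hpt
    _ = A ^ p * C * ∫⁻ x, ∫⁻ y, (m ‖x‖)⁻¹ *
          (annulus d ‖x‖).indicator (fun y => G y ^ p) y ∂μ ∂μ :=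
        lintegral_const_mul' _ _ (ENNReal.mul_ne_top (ENNReal.rpow_ne_top_of_nonneg hp0.le hAt) hC)
    _ = A ^ p * C * ∫⁻ y, ∫⁻ x, (m ‖x‖)⁻¹ *
          (annulus d ‖x‖).indicator (fun y => G y ^ p) y ∂μ ∂μ := by
        rw [lintegral_lintegral_swap hmeas.aemeasurable]
    _ ≤ A ^ p * C * ∫⁻ y, G y ^ p ∂μ := mul_le_mul' le_rfl (lintegral_mono hinner)
    _ < ⊤ := ENNReal.mul_lt_top
        (ENNReal.mul_ne_top (ENNReal.rpow_ne_top_of_nonneg hp0.le hAt) hC).lt_top hγp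

end

section
variable {d : ℕ} {p : ℝ} {w : EuclideanSpace ℝ (Fin d) → ℝ}

/-- If radial summability fails, the homogeneous Sobolev space contains a continuous radial function
tending to infinity. -/
theorem exists_radial_of_not_radiallySummable (hd : 1 ≤ d) (hp : 1 ≤ p)
    (hw : IsMuckenhouptWeight p w) (hK : ¬ RadiallySummable d p w) :
    ∃ v : ℝ → ℝ, Tendsto v atTop atTop ∧
      (fun x : EuclideanSpace ℝ (Fin d) => (v ‖x‖ : EReal)) ∈ homogeneousSobolev d p w := by
  unfold RadiallySummable at hK
  push Not at hK
  obtain ⟨G, hG, hGp, hGtop⟩ := hK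
  rw [top_le_iff] at hGtop
  have hp0 : 0 < p := by linarith
  have hB : MeasurableSet (Metric.ball (0 : EuclideanSpace ℝ (Fin d)) 1)ᶜ :=
    Metric.isOpen_ball.measurableSet.compl
  set γ : EuclideanSpace ℝ (Fin d) → ℝ :=
    (Metric.ball (0 : EuclideanSpace ℝ (Fin d)) 1)ᶜ.indicator fun y => (G y).toReal with hγ_def
  have hγm : Measurable γ := hG.ennreal_toReal.indicator hB
  have h0 : ∀ y, 0 ≤ γ y := fun y => Set.indicator_nonneg (fun _ _ => ENNReal.toReal_nonneg) y
  have h1 : ∀ y, ‖y‖ < 1 → γ y = 0 := fun y hy => by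
    rw [hγ_def, Set.indicator_of_notMem]
    simpa using hy
  have hle : ∀ y, ENNReal.ofReal (γ y) ≤ G y := by
    intro y
    refine le_trans (ENNReal.ofReal_le_ofReal (Set.indicator_le_self' (fun _ _ => ?_) y))
      ENNReal.ofReal_toReal_le
    exact ENNReal.toReal_nonneg
  have hγ : LocallyIntegrable γ volume := by
    refine locallyIntegrable_of_integrableOn_ball fun R hR => ⟨hγm.aestronglyMeasurable, ?_⟩
    refine lt_of_le_of_lt (lintegral_mono fun y => ?_) (hw.setLIntegral_ball_lt_top hp hG hGp hR)
    rw [Real.enorm_of_nonneg (h0 y)]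
    exact hle y
  have hfin : ∀ᵐ y, G y < ⊤ := by
    refine hw.volume_absolutelyContinuous.ae_le ?_
    filter_upwards [ae_lt_top (hG.pow_const p) hGp.ne] with y hy
    exact lt_of_not_ge fun h => by
      rw [top_le_iff.1 h, ENNReal.top_rpow_of_pos hp0] at hy
      exact lt_irrefl _ hy
  have htop : ∫⁻ y, ENNReal.ofReal (γ y) * radialKernel d y = ⊤ := by
    rw [← hGtop, ← lintegral_indicator hB]
    refine lintegral_congr_ae ?_
    filter_upwards [hfin] with y hy
    by_cases hyB : y ∈ (Metric.ball (0 : EuclideanSpace ℝ (Fin d)) 1)ᶜ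
    · rw [Set.indicator_of_mem hyB, hγ_def, Set.indicator_of_mem hyB, ENNReal.ofReal_toReal hy.ne]
    · rw [Set.indicator_of_notMem hyB, hγ_def, Set.indicator_of_notMem hyB, ENNReal.ofReal_zero,
        zero_mul]
  have hγp : ∫⁻ y, ENNReal.ofReal (γ y) ^ p ∂(weightedMeasure w) < ⊤ :=
    lt_of_le_of_lt (lintegral_mono fun y => ENNReal.rpow_le_rpow (hle y) hp0.le) hGp
  have hρ := continuous_annulusMean hd hγ
  have hρ0 := annulusMean_nonneg h0
  exact ⟨fun r => ∫ s in (0 : ℝ)..r, annulusMean γ s,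
    tendsto_primitive_atTop hρ hρ0 (lintegral_annulusMean_eq_top hγ hγm h0 h1 hd htop),
    radial_mem_homogeneousSobolev hp hw hρ hρ0 (fun _ hr => annulusMean_eq_zero h1 hr)
      (hw.lintegral_annulusMean_rpow_lt_top hp hγ hγm h0 h1 hγp)⟩

/-! ### Equivalence of the conditions -/

theorem HasRadialLimit.boundedLiminfOnSomeRay (hd : 1 ≤ d)
    {u : EuclideanSpace ℝ (Fin d) → EReal} {c : ℝ} (h : HasRadialLimit u c) :
    BoundedLiminfOnSomeRay u := by
  have : (ae (surfaceMeasure d)).NeBot := ae_neBot.2 (surfaceMeasure_ne_zero hd)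
  obtain ⟨ξ, hξ⟩ := Eventually.exists h
  refine ⟨ξ, lt_of_le_of_lt (b := ENNReal.ofReal (|c| + 1)) ?_ ENNReal.ofReal_lt_top⟩
  refine liminf_le_of_frequently_le' (Eventually.frequently ?_)
  have hlt1 : ((c - 1 : ℝ) : EReal) < c := by exact_mod_cast sub_one_lt c
  have hlt2 : (c : EReal) < ((c + 1 : ℝ) : EReal) := by exact_mod_cast lt_add_one c
  filter_upwards [hξ.eventually (Ioo_mem_nhds hlt1 hlt2)] with t ht
  obtain ⟨ht1, ht2⟩ := ht
  induction hv : u (t • (ξ : EuclideanSpace ℝ (Fin d))) with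
  | bot => rw [hv] at ht1; simp at ht1
  | top => rw [hv] at ht2; simp at ht2
  | coe v =>
    rw [hv, EReal.coe_lt_coe_iff] at ht1 ht2
    rw [EReal.abs_def]
    refine ENNReal.ofReal_le_ofReal ?_
    rw [abs_le]
    constructor <;> linarith [neg_abs_le c, le_abs_self c]

theorem HasRadialLimit.unique (hd : 1 ≤ d) {u : EuclideanSpace ℝ (Fin d) → EReal} {c c' : ℝ}
    (h : HasRadialLimit u c) (h' : HasRadialLimit u c') : c = c' := by
  have : (ae (surfaceMeasure d)).NeBot := ae_neBot.2 (surfaceMeasure_ne_zero hd)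
  obtain ⟨ξ, h1, h2⟩ := (Eventually.and h h').exists
  exact EReal.coe_injective (tendsto_nhds_unique h1 h2)

end

theorem mainTheorem3 (d : ℕ) (hd : 2 ≤ d) (p : ℝ) (hp : 1 ≤ p)
    (w : EuclideanSpace ℝ (Fin d) → ℝ) (hw : IsMuckenhouptWeight p w) :
    (((∀ u ∈ homogeneousSobolev d p w, BoundedLiminfOnSomeRay u) ∨
        (∀ u ∈ homogeneousSobolev d p w, ∃ c : ℝ, HasRadialLimit u c)) →
      ∀ u ∈ homogeneousSobolev d p w,
        (∃! c : ℝ, HasRadialLimit u c) ∧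
        ∀ c : ℝ, HasRadialLimit u c →
          HasSphericalMeanLimit u c ∧ HasAnnularMeanLimit u c ∧ HasBallMeanLimit u c) ∧
    List.TFAE [
      ∀ u ∈ homogeneousSobolev d p w, BoundedLiminfOnSomeRay u,
      ∀ u ∈ homogeneousSobolev d p w, ∃ c : ℝ, HasRadialLimit u c,
      ∀ u ∈ homogeneousSobolev d p w, ∃ c : ℝ, HasSphericalMeanLimit u c,
      ∀ u ∈ homogeneousSobolev d p w, ∃ c : ℝ, HasAnnularMeanLimit u c,
      ∀ u ∈ homogeneousSobolev d p w, ∃ c : ℝ, HasBallMeanLimit u c,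
      ∀ u ∈ homogeneousSobolev d p w, ∃ c : ℝ,
        HasSphericalMeanLimit u c ∨ HasAnnularMeanLimit u c ∨ HasBallMeanLimit u c] := by
  have hd1 : 1 ≤ d := by omega
  have hall : RadiallySummable d p w → ∀ u ∈ homogeneousSobolev d p w, ∃ c : ℝ,
      HasRadialLimit u c ∧ HasSphericalMeanLimit u c ∧ HasAnnularMeanLimit u c ∧
        HasBallMeanLimit u c := fun hK u hu => hK.exists_limits hd hp hu
  have hK1 : (∀ u ∈ homogeneousSobolev d p w, BoundedLiminfOnSomeRay u) →
      RadiallySummable d p w := by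
    intro h
    by_contra hK
    obtain ⟨v, hv, hmem⟩ := exists_radial_of_not_radiallySummable hd1 hp hw hK
    exact not_boundedLiminfOnSomeRay_of_tendsto hv (h _ hmem)
  have hK6 : (∀ u ∈ homogeneousSobolev d p w, ∃ c : ℝ,
      HasSphericalMeanLimit u c ∨ HasAnnularMeanLimit u c ∨ HasBallMeanLimit u c) →
      RadiallySummable d p w := by
    intro h
    by_contra hK
    obtain ⟨v, hv, hmem⟩ := exists_radial_of_not_radiallySummable hd1 hp hw hK
    obtain ⟨c, hc | hc | hc⟩ := h _ hmem
    · exact not_hasSphericalMeanLimit_of_tendsto hd1 hv c hc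
    · exact not_hasAnnularMeanLimit_of_tendsto hd1 hv c hc
    · exact not_hasBallMeanLimit_of_tendsto hd1 hv c hc
  have h21 : (∀ u ∈ homogeneousSobolev d p w, ∃ c : ℝ, HasRadialLimit u c) →
      ∀ u ∈ homogeneousSobolev d p w, BoundedLiminfOnSomeRay u := fun h u hu =>
    (h u hu).elim fun _ hc => hc.boundedLiminfOnSomeRay hd1
  refine ⟨fun h u hu => ?_, ?_⟩
  · obtain ⟨c, hc, hlim⟩ := hall (h.elim hK1 fun h => hK1 (h21 h)) u hu
    refine ⟨⟨c, hc, fun c' hc' => hc'.unique hd1 hc⟩, fun c' hc' => ?_⟩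
    rwa [hc'.unique hd1 hc]
  · tfae_have 2 → 1 := h21
    tfae_have 1 → 2 := fun h u hu =>
      (hall (hK1 h) u hu).elim fun c hc => ⟨c, hc.1⟩
    tfae_have 1 → 3 := fun h u hu =>
      (hall (hK1 h) u hu).elim fun c hc => ⟨c, hc.2.1⟩
    tfae_have 1 → 4 := fun h u hu =>
      (hall (hK1 h) u hu).elim fun c hc => ⟨c, hc.2.2.1⟩
    tfae_have 1 → 5 := fun h u hu =>
      (hall (hK1 h) u hu).elim fun c hc => ⟨c, hc.2.2.2⟩
    tfae_have 3 → 6 := fun h u hu => (h u hu).imp fun _ hc => Or.inl hc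
    tfae_have 4 → 6 := fun h u hu => (h u hu).imp fun _ hc => Or.inr (Or.inl hc)
    tfae_have 5 → 6 := fun h u hu => (h u hu).imp fun _ hc => Or.inr (Or.inr hc)
    tfae_have 6 → 1 := fun h u hu =>
      (hall (hK6 h) u hu).elim fun _ hc => hc.1.boundedLiminfOnSomeRay hd1
    tfae_finish
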